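/- Let $\mathbb T$ be the unit circle with its normalized Lebesgue measure and let $A$ be the bounded (Kalish-type) operator on the complex Hilbert space $L^2(\mathbb T)$ defined for $f\in L^2(\mathbb T)$ and $0\le\theta<2\pi$ by \[ Af(e^{i\theta})=e^{i\theta}f(e^{i\theta})-\int_0^{\theta} i e^{it}f(e^{it})\,dt . \] Then $A$ is universal for invertible ergodic systems: for every standard Borel space $X$, every non-atomic Borel probability measure $\mu$ on $X$, and every ergodic $\mu$-preserving transformation $T$ of $X$ that is invertible (that is, possesses a measure-preserving inverse modulo sets of $\mu$-measure zero), there exists an $A$-invariant Borel probability measure $\nu$ on $L^2(\mathbb T)$ with full support (every non-empty open set has positive $\nu$-measure) such that the systems $(X,\mu;T)$ and $(L^2(\mathbb T),\nu;A)$ are isomorphic. Here isomorphic means that there is a measure-preserving map $\Phi:X\to L^2(\mathbb T)$, possessing a measure-preserving inverse modulo sets of measure zero, such that $\Phi\circ T=A\circ\Phi$ $\mu$-almost everywhere. Moreover, $A$ has no non-trivial eigenvectorfield that is analytic near a point of $\mathbb T$: if $\lambda_0\in\mathbb T$, if $E$ is an $L^2(\mathbb T)$-valued map that is analytic in a neighbourhood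 of $\lambda_0$ in $\mathbb C$, and if $A E(\lambda)=\lambda E(\lambda)$ for all $\lambda\in\mathbb T$ sufficiently close to $\lambda_0$, then $E(\lambda)=0$ for all $\lambda$ in a neighbourhood of $\lambda_0$. -/

import Mathlib

open MeasureTheory Filter Topology

/-! ### Universal operators -/

section Universality

variable {X Y : Type*} [MeasurableSpace X] [MeasurableSpace Y]

/-- A measure-preserving transformation `T` of `(X, μ)` is invertible if it has a
measure-preserving two-sided inverse, up to sets of measure zero. -/
def IsInvertibleSystem (T : X → X) (μ : Measure X) : Prop :=
  MeasurePreserving T μ μ ∧ ∃ S : X → X, MeasurePreserving S μ μ ∧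
    (∀ᵐ x ∂μ, S (T x) = x) ∧ (∀ᵐ x ∂μ, T (S x) = x)

/-- The systems `(X, μ; T)` and `(Y, ν; S)` are isomorphic: there is a measure-preserving map
`Φ : X → Y`, with a measure-preserving inverse `Ψ` up to sets of measure zero, such that
`Φ ∘ T = S ∘ Φ` almost everywhere. -/
def AreIsomorphicSystems (T : X → X) (μ : Measure X) (S : Y → Y) (ν : Measure Y) : Prop :=
  ∃ (Φ : X → Y) (Ψ : Y → X), MeasurePreserving Φ μ ν ∧ MeasurePreserving Ψ ν μ ∧
    (∀ᵐ x ∂μ, Ψ (Φ x) = x) ∧ (∀ᵐ y ∂ν, Φ (Ψ y) = y) ∧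
    (∀ᵐ x ∂μ, Φ (T x) = S (Φ x))

end Universality

/-- A bounded operator `A` on a Banach space `Z` is universal for invertible ergodic systems if
every invertible ergodic system on a standard (non-atomic) probability space is isomorphic to
`(Z, ν; A)` for some `A`-invariant Borel probability measure `ν` on `Z` with full support. -/
def UniversalForInvertibleErgodicSystems.{u, v, w} {𝕜 : Type v} [RCLike 𝕜]
    {Z : Type w} [NormedAddCommGroup Z] [NormedSpace 𝕜 Z] [MeasurableSpace Z] [BorelSpace Z]
    (A : Z →L[𝕜] Z) : Prop :=
  ∀ (X : Type u) [MeasurableSpace X] [StandardBorelSpace X]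
    (μ : Measure X) [IsProbabilityMeasure μ] (T : X → X),
    (∀ x : X, μ {x} = 0) → Ergodic T μ → IsInvertibleSystem T μ →
    ∃ ν : Measure Z, IsProbabilityMeasure ν ∧
      (∀ U : Set Z, IsOpen U → U.Nonempty → 0 < ν U) ∧
      MeasurePreserving A ν ν ∧ AreIsomorphicSystems T μ A ν

/-! ### Eigenvectorfields -/

/-- The map `E` is analytic in a neighbourhood of `z₀` in `ℂ`, and it is an eigenvectorfield of
`A` there: `A E(z) = z E(z)` for every unimodular `z` near `z₀`. -/
def IsAnalyticEigenvectorfieldNear {Z : Type*} [NormedAddCommGroup Z] [NormedSpace ℂ Z]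
    (A : Z →L[ℂ] Z) (E : ℂ → Z) (z₀ : ℂ) : Prop :=
  AnalyticAt ℂ E z₀ ∧ ∀ᶠ z in 𝓝 z₀, ‖z‖ = 1 → A (E z) = z • E z

/-! ### The Kalish-type operator

The unit circle `𝕋` is parametrized by `ℝ / 2πℤ`: the class of `θ` stands for the point
`exp (i θ)`, which is `AddCircle.toCircle θ`. -/

noncomputable section Kalish

open Complex

instance fact_zero_lt_two_pi : Fact (0 < 2 * Real.pi) := ⟨Real.two_pi_pos⟩

/-- The unit circle `𝕋`. -/
abbrev 𝕋 : Type := AddCircle (2 * Real.pi)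

/-- The complex Hilbert space `L²(𝕋)`, for the normalized Lebesgue measure. -/
abbrev L2T : Type := Lp ℂ 2 (AddCircle.haarAddCircle : Measure 𝕋)

instance : MeasurableSpace L2T := borel L2T

instance : BorelSpace L2T := ⟨rfl⟩

/-- The representative in `[0, 2π)` of a point of `𝕋`. -/
def angle (x : 𝕋) : ℝ := (AddCircle.equivIco (2 * Real.pi) 0 x : ℝ)

/-- `∫₀^θ i e^{it} f(e^{it}) dt`, for `0 ≤ θ < 2π` representing the point `x`. -/
def kalishIntegral (f : 𝕋 → ℂ) (x : 𝕋) : ℂ :=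
  ∫ t in (0 : ℝ)..angle x, I * exp (t * I) * f (t : 𝕋)

/-- `e^{iθ} f(e^{iθ}) - ∫₀^θ i e^{it} f(e^{it}) dt`, for `0 ≤ θ < 2π` representing `x`. -/
def kalishFun (f : 𝕋 → ℂ) (x : 𝕋) : ℂ :=
  exp (angle x * I) * f x - kalishIntegral f x

theorem angle_mem (x : 𝕋) : angle x ∈ Set.Ico (0 : ℝ) (2 * Real.pi) := by
  have h := (AddCircle.equivIco (2 * Real.pi) 0 x).2
  exact ⟨h.1, h.2.trans_eq (zero_add _)⟩

theorem coe_angle (x : 𝕋) : (angle x : 𝕋) = x :=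
  (AddCircle.equivIco (2 * Real.pi) 0).symm_apply_apply x

theorem measurable_angle : Measurable angle :=
  measurable_subtype_coe.comp (AddCircle.measurableEquivIco (2 * Real.pi) 0).measurable

theorem measurePreserving_coe_Ioc :
    MeasurePreserving (fun t : ℝ => (t : 𝕋)) (volume.restrict (Set.Ioc 0 (2 * Real.pi))) volume := by
  have h := AddCircle.measurePreserving_mk (2 * Real.pi) 0
  rwa [zero_add] at h

theorem integrable_volume_of_L2T (f : L2T) : Integrable f (volume : Measure 𝕋) := by
  have h : Integrable f (AddCircle.haarAddCircle : Measure 𝕋) :=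
    (Lp.memLp f).integrable (by norm_num)
  rw [AddCircle.volume_eq_smul_haarAddCircle]
  exact h.smul_measure ENNReal.ofReal_ne_top

theorem intervalIntegrable_of_L2T (f : L2T) :
    IntervalIntegrable (fun t : ℝ => I * exp (t * I) * f (t : 𝕋)) volume 0 (2 * Real.pi) := by
  rw [intervalIntegrable_iff_integrableOn_Ioc_of_le Real.two_pi_pos.le]
  have h : Integrable (fun t : ℝ => f (t : 𝕋)) (volume.restrict (Set.Ioc 0 (2 * Real.pi))) :=
    measurePreserving_coe_Ioc.integrable_comp_of_integrable (integrable_volume_of_L2T f)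
  refine h.bdd_mul (c := 1) (Continuous.aestronglyMeasurable (by fun_prop)) ?_
  filter_upwards with t
  simp [norm_exp_ofReal_mul_I]

theorem intervalIntegrable_of_L2T_angle (f : L2T) (x : 𝕋) :
    IntervalIntegrable (fun t : ℝ => I * exp (t * I) * f (t : 𝕋)) volume 0 (angle x) := by
  refine (intervalIntegrable_of_L2T f).mono_set ?_
  rw [Set.uIcc_of_le (angle_mem x).1, Set.uIcc_of_le Real.two_pi_pos.le]
  exact Set.Icc_subset_Icc_right (angle_mem x).2.le

theorem kalishIntegral_congr {f g : 𝕋 → ℂ} (h : f =ᵐ[AddCircle.haarAddCircle] g) (x : 𝕋) :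
    kalishIntegral f x = kalishIntegral g x := by
  have h1 : f =ᵐ[volume] g := by
    rw [AddCircle.volume_eq_smul_haarAddCircle]
    exact Measure.ae_smul_measure h _
  have h2 := measurePreserving_coe_Ioc.quasiMeasurePreserving.ae h1
  rw [ae_restrict_iff' measurableSet_Ioc] at h2
  refine intervalIntegral.integral_congr_ae ?_
  filter_upwards [h2] with t ht hm
  rw [Set.uIoc_of_le (angle_mem x).1] at hm
  rw [ht ⟨hm.1, hm.2.trans (angle_mem x).2.le⟩]

theorem kalishFun_congr {f g : 𝕋 → ℂ} (h : f =ᵐ[AddCircle.haarAddCircle] g) :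
    kalishFun f =ᵐ[AddCircle.haarAddCircle] kalishFun g := by
  filter_upwards [h] with x hx
  rw [kalishFun, kalishFun, hx, kalishIntegral_congr h]

theorem measurable_kalishIntegral (f : L2T) : Measurable (kalishIntegral f) := by
  have hc : ContinuousOn (fun θ : ℝ => ∫ t in (0 : ℝ)..θ, I * exp (t * I) * f (t : 𝕋))
      (Set.Icc 0 (2 * Real.pi)) := by
    have h := intervalIntegral.continuousOn_primitive_interval' (intervalIntegrable_of_L2T f)
      Set.left_mem_uIcc
    rwa [Set.uIcc_of_le Real.two_pi_pos.le] at h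
  have hm : Measurable fun x : 𝕋 =>
      (⟨angle x, (angle_mem x).1, (angle_mem x).2.le⟩ : Set.Icc 0 (2 * Real.pi)) :=
    measurable_angle.subtype_mk
  exact hc.domRestrict.measurable.comp hm

theorem norm_kalishIntegral_le (f : L2T) (x : 𝕋) :
    ‖kalishIntegral f x‖ ≤ 2 * Real.pi * ‖f‖ := by
  have hL2 : MemLp f 2 (AddCircle.haarAddCircle : Measure 𝕋) := Lp.memLp f
  have h1 : ‖kalishIntegral f x‖ ≤ ∫ t in (0 : ℝ)..angle x, ‖f (t : 𝕋)‖ := by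
    refine (intervalIntegral.norm_integral_le_integral_norm (angle_mem x).1).trans_eq ?_
    simp [norm_exp_ofReal_mul_I]
  have hint : IntervalIntegrable (fun t : ℝ => ‖f (t : 𝕋)‖) volume 0 (2 * Real.pi) := by
    refine (intervalIntegrable_of_L2T f).norm.congr ?_
    intro t _
    simp [norm_exp_ofReal_mul_I]
  have h2 : ∫ t in (0 : ℝ)..angle x, ‖f (t : 𝕋)‖ ≤ ∫ t in (0 : ℝ)..2 * Real.pi, ‖f (t : 𝕋)‖ :=
    intervalIntegral.integral_mono_interval le_rfl (angle_mem x).1 (angle_mem x).2.le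
      (Eventually.of_forall fun t => norm_nonneg _) hint
  have h3 : ∫ t in (0 : ℝ)..2 * Real.pi, ‖f (t : 𝕋)‖ = ∫ y : 𝕋, ‖f y‖ := by
    have h := AddCircle.intervalIntegral_preimage (2 * Real.pi) 0 fun y : 𝕋 => ‖f y‖
    rwa [zero_add] at h
  have h4 : ∫ y : 𝕋, ‖f y‖ = 2 * Real.pi * ∫ y : 𝕋, ‖f y‖ ∂AddCircle.haarAddCircle := by
    rw [AddCircle.integral_haarAddCircle, smul_eq_mul, mul_inv_cancel_left₀ Real.two_pi_pos.ne']
  have h5 : ∫ y : 𝕋, ‖f y‖ ∂AddCircle.haarAddCircle ≤ ‖f‖ := by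
    rw [integral_norm_eq_lintegral_enorm hL2.1, ← eLpNorm_one_eq_lintegral_enorm, Lp.norm_def]
    exact ENNReal.toReal_mono hL2.2.ne
      (eLpNorm_le_eLpNorm_of_exponent_le (by norm_num) hL2.1)
  calc ‖kalishIntegral f x‖ ≤ 2 * Real.pi * ∫ y : 𝕋, ‖f y‖ ∂AddCircle.haarAddCircle := by
        rw [← h4, ← h3]; exact h1.trans h2
    _ ≤ 2 * Real.pi * ‖f‖ := mul_le_mul_of_nonneg_left h5 Real.two_pi_pos.le

theorem memLp_exp_angle_mul (f : L2T) :
    MemLp (fun x : 𝕋 => exp (angle x * I) * f x) 2 AddCircle.haarAddCircle := by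
  refine (Lp.memLp f).of_le (AEStronglyMeasurable.mul ?_ (Lp.memLp f).1) ?_
  · exact (Measurable.aestronglyMeasurable
      (((measurable_ofReal.comp measurable_angle).mul_const I).cexp))
  · filter_upwards with x
    simp [norm_exp_ofReal_mul_I]

theorem memLp_kalishIntegral (f : L2T) :
    MemLp (kalishIntegral f) 2 (AddCircle.haarAddCircle : Measure 𝕋) :=
  MemLp.of_bound (measurable_kalishIntegral f).aestronglyMeasurable _
    (Eventually.of_forall (norm_kalishIntegral_le f))

theorem memLp_kalishFun (f : L2T) :
    MemLp (kalishFun f) 2 (AddCircle.haarAddCircle : Measure 𝕋) :=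
  (memLp_exp_angle_mul f).sub (memLp_kalishIntegral f)

theorem norm_kalishFun_le (f : L2T) :
    ‖(memLp_kalishFun f).toLp‖ ≤ (1 + 2 * Real.pi) * ‖f‖ := by
  have h : (memLp_kalishFun f).toLp =
      (memLp_exp_angle_mul f).toLp - (memLp_kalishIntegral f).toLp :=
    MemLp.toLp_sub (memLp_exp_angle_mul f) (memLp_kalishIntegral f)
  have h1 : ‖(memLp_exp_angle_mul f).toLp‖ ≤ ‖f‖ := by
    refine Lp.norm_le_norm_of_ae_le ?_
    filter_upwards [(memLp_exp_angle_mul f).coeFn_toLp] with x hx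
    rw [hx]
    simp [norm_exp_ofReal_mul_I]
  have h2 : ‖(memLp_kalishIntegral f).toLp‖ ≤ 2 * Real.pi * ‖f‖ := by
    have hC : 0 ≤ 2 * Real.pi * ‖f‖ := mul_nonneg Real.two_pi_pos.le (norm_nonneg f)
    have h3 := Lp.norm_le_of_ae_bound (f := (memLp_kalishIntegral f).toLp) hC (by
      filter_upwards [(memLp_kalishIntegral f).coeFn_toLp] with x hx
      rw [hx]
      exact norm_kalishIntegral_le f x)
    have h4 : measureUnivNNReal (AddCircle.haarAddCircle : Measure 𝕋) = 1 := by
      simp [measureUnivNNReal]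
    rw [h4] at h3
    simpa using h3
  rw [h]
  refine (norm_sub_le _ _).trans ?_
  linarith

/-- The Kalish-type operator `A` on `L²(𝕋)`:
`A f(e^{iθ}) = e^{iθ} f(e^{iθ}) - ∫₀^θ i e^{it} f(e^{it}) dt` for `0 ≤ θ < 2π`. -/
def kalishOperator : L2T →L[ℂ] L2T :=
  LinearMap.mkContinuous
    { toFun := fun f => (memLp_kalishFun f).toLp (kalishFun f)
      map_add' := fun f g => by
        rw [← MemLp.toLp_add]
        refine MemLp.toLp_congr _ _ ((kalishFun_congr (Lp.coeFn_add f g)).trans ?_)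
        filter_upwards with x
        simp only [kalishFun, kalishIntegral, Pi.add_apply, mul_add]
        rw [intervalIntegral.integral_add (intervalIntegrable_of_L2T_angle f x)
          (intervalIntegrable_of_L2T_angle g x)]
        ring
      map_smul' := fun c f => by
        rw [RingHom.id_apply, ← MemLp.toLp_const_smul]
        refine MemLp.toLp_congr _ _ ((kalishFun_congr (Lp.coeFn_smul c f)).trans ?_)
        filter_upwards with x
        simp only [kalishFun, kalishIntegral, Pi.smul_apply, smul_eq_mul, mul_left_comm _ c]
        rw [intervalIntegral.integral_const_mul]
        ring }
    (1 + 2 * Real.pi) norm_kalishFun_le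

end Kalish

universe u

/-!
The Kalish operator `A` is the operator of multiplication by `e^{iθ}` conjugated by the Volterra
operator: if `F' = G` and `F(0) = 0`, then `A F` is the primitive of `e^{iθ} G` vanishing at `0`.

*Universality.* The primitives `z n` of the characters `e^{inθ}` satisfy `A (z n) = z (n + 1)`, and
so do their differences `w n = z n - z (n + 1)`. Apart from an error of size `1 / n²` in a fixed
plane, `w n` is a combination of the orthonormal vectors `e^{inθ}` and `e^{i(n+1)θ}` with
coefficients of size `1 / |n|`; hence `∑ b n • w n` converges as
soon as `∑ |b n|² / (1 + n²)` does. For an automorphism `e` of `(X, μ)` this gives a bounded coding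
operator `f ↦ (x ↦ ∑ f (e⁻ⁿ x) • w n)` from `L²(μ)` to `L²(μ; L²(𝕋))` (`coding`), and each coding
intertwines `e` with `A`. It remains to find `f` whose coding is almost everywhere injective and
charges all open sets; the distribution of the coding is then the required measure. This is done by
the Baire category theorem in `L²(μ)`.
- Charging a given open set is an open condition. It is dense because `μ` is aperiodic and the span
  of the `w n` is dense: the values of a simple function may be prescribed on a tower of small
  measure (`dense_setOf_coding_charges`).
- Let `t` be a bounded Borel injection of `X` into the line. That `t` is within `δ`, in `L¹`, of a
  bounded continuous function of the coding is an open condition. It is dense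
  (`dense_setOf_coding_decodes`): the coding of a bounded function `g` determines `g - g ∘ e`, and
  any simple function can be perturbed so that this difference is injective, by adding a small
  multiple of the map `t + i t²` into the parabola, which is a Sidon set
  (`exists_perturbation_sub_injective`).

*Eigenvectorfields.* If `A f = e^{is} f` and `F` is the primitive of `i e^{iθ} f`, then
`F / (e^{iθ} - e^{is})` is constant on every interval of angles that avoids `s`
(`eigenvector_eq_zero_on`). So `f` vanishes on the angles below `s`, and it vanishes altogether if it
also vanishes up to some angle larger than `s`. If `E` is an analytic eigenvectorfield, its
restriction to the angles below `b` vanishes at `e^{is}` for `s > b`, hence, by the identity theorem,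
also for `s` slightly smaller than `b`; for those `s` the whole vector `E(e^{is})` is zero, and a
second application of the identity theorem finishes the proof.
-/

/-! ### Primitives of characters and the shifted sequence -/

section Primitives

open Complex

theorem secondCountableTopology_L2T : SecondCountableTopology L2T := by
  have : Fact ((2 : ENNReal) ≠ ⊤) := ⟨by norm_num⟩
  infer_instance

/-- The primitive `∫₀^θ e^{int} dt` of the `n`-th character, as a function on the circle. -/
noncomputable def charPrimitiveFun (n : ℤ) (x : 𝕋) : ℂ :=
  ∫ t in (0 : ℝ)..angle x, exp (n * t * I)

theorem angle_coe_of_mem {t : ℝ} (ht : t ∈ Set.Ico (0 : ℝ) (2 * Real.pi)) :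
    angle (t : 𝕋) = t := by
  have h : t ∈ Set.Ico (0 : ℝ) (0 + 2 * Real.pi) := by simpa using ht
  rw [angle, AddCircle.equivIco_coe_eq h]

theorem hasDerivAt_primitive_exp (n : ℤ) (t : ℝ) :
    HasDerivAt (fun s : ℝ => ∫ u in (0 : ℝ)..s, exp (n * u * I)) (exp (n * t * I)) t := by
  have hc : Continuous fun u : ℝ => exp (n * u * I) := by fun_prop
  exact intervalIntegral.integral_hasDerivAt_right (hc.intervalIntegrable _ _)
    (hc.stronglyMeasurableAtFilter _ _) hc.continuousAt

theorem hasDerivAt_exp_mul_I (t : ℝ) :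
    HasDerivAt (fun s : ℝ => exp (s * I)) (I * exp (t * I)) t := by
  have h : HasDerivAt (fun s : ℝ => (s : ℂ) * I) (1 * I) t :=
    (Complex.ofRealCLM.hasDerivAt (x := t)).mul_const I
  convert h.cexp using 1
  ring

theorem measurable_charPrimitiveFun (n : ℤ) : Measurable (charPrimitiveFun n) := by
  have hc : Continuous fun s : ℝ => ∫ u in (0 : ℝ)..s, exp (n * u * I) :=
    continuous_iff_continuousAt.2 fun t => (hasDerivAt_primitive_exp n t).continuousAt
  exact hc.measurable.comp measurable_angle

theorem memLp_charPrimitiveFun (n : ℤ) :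
    MemLp (charPrimitiveFun n) 2 (AddCircle.haarAddCircle : Measure 𝕋) := by
  refine MemLp.of_bound (measurable_charPrimitiveFun n).aestronglyMeasurable (2 * Real.pi)
    (Eventually.of_forall fun x => ?_)
  have h := intervalIntegral.norm_integral_le_of_norm_le_const (a := 0) (b := angle x)
    (f := fun t : ℝ => exp (n * t * I)) (C := 1) (fun t _ => by
      have : (n : ℂ) * t * I = ((n * t : ℝ) : ℂ) * I := by push_cast; ring
      rw [this, norm_exp_ofReal_mul_I])
  rw [sub_zero, one_mul, abs_of_nonneg (angle_mem x).1] at h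
  exact h.trans (angle_mem x).2.le

/-- The primitive of the `n`-th character, as an element of `L²(𝕋)`. -/
noncomputable def charPrimitive (n : ℤ) : L2T := (memLp_charPrimitiveFun n).toLp

/-- Integration by parts: `A` acts on primitives vanishing at `0` as multiplication by `e^{iθ}` acts
on their derivatives. -/
theorem kalishFun_charPrimitiveFun (n : ℤ) (x : 𝕋) :
    kalishFun (charPrimitiveFun n) x = charPrimitiveFun (n + 1) x := by
  have hx := angle_mem x
  have h1 : kalishIntegral (charPrimitiveFun n) x = ∫ t in (0 : ℝ)..angle x,
      I * exp (t * I) * ∫ u in (0 : ℝ)..t, exp (n * u * I) := by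
    refine intervalIntegral.integral_congr fun t ht => ?_
    rw [Set.uIcc_of_le hx.1] at ht
    simp only [charPrimitiveFun, angle_coe_of_mem ⟨ht.1, ht.2.trans_lt hx.2⟩]
  have h2 : ∀ t : ℝ, HasDerivAt (fun s : ℝ => exp (s * I) * (∫ u in (0 : ℝ)..s, exp (n * u * I))
      - ∫ u in (0 : ℝ)..s, exp (((n + 1 : ℤ) : ℂ) * u * I))
      (I * exp (t * I) * ∫ u in (0 : ℝ)..t, exp (n * u * I)) t := fun t => by
    refine (((hasDerivAt_exp_mul_I t).mul (hasDerivAt_primitive_exp n t)).sub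
      (hasDerivAt_primitive_exp (n + 1) t)).congr_deriv ?_
    have : exp (((n + 1 : ℤ) : ℂ) * t * I) = exp (t * I) * exp (n * t * I) := by
      rw [← Complex.exp_add]; push_cast; ring_nf
    rw [this]; ring
  have hc : Continuous fun t : ℝ => I * exp (t * I) * ∫ u in (0 : ℝ)..t, exp (n * u * I) := by
    have : Continuous fun s : ℝ => ∫ u in (0 : ℝ)..s, exp (n * u * I) :=
      continuous_iff_continuousAt.2 fun t => (hasDerivAt_primitive_exp n t).continuousAt
    fun_prop
  have h3 := intervalIntegral.integral_eq_sub_of_hasDerivAt (fun t _ => h2 t)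
    (hc.intervalIntegrable 0 (angle x))
  rw [kalishFun, h1, h3]
  simp [charPrimitiveFun]

theorem kalishOperator_apply (f : L2T) :
    kalishOperator f = (memLp_kalishFun f).toLp (kalishFun f) := rfl

theorem kalishOperator_charPrimitive (n : ℤ) :
    kalishOperator (charPrimitive n) = charPrimitive (n + 1) := by
  refine MemLp.toLp_congr (memLp_kalishFun _) (memLp_charPrimitiveFun _)
    ((kalishFun_congr (memLp_charPrimitiveFun n).coeFn_toLp).trans ?_)
  exact Eventually.of_forall (kalishFun_charPrimitiveFun n)

theorem fourier_eq_exp_angle (n : ℤ) (x : 𝕋) : fourier n x = exp (n * angle x * I) := by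
  conv_lhs => rw [← coe_angle x]
  rw [fourier_coe_apply]
  congr 1
  have : (Real.pi : ℂ) ≠ 0 := by exact_mod_cast Real.pi_ne_zero
  push_cast
  field_simp

theorem charPrimitive_eq {n : ℤ} (hn : n ≠ 0) :
    charPrimitive n = ((n : ℂ) * I)⁻¹ • (fourierLp 2 n - fourierLp 2 0 : L2T) := by
  have hn' : (n : ℂ) * I ≠ 0 := mul_ne_zero (by exact_mod_cast hn) I_ne_zero
  refine Lp.ext ?_
  filter_upwards [(memLp_charPrimitiveFun n).coeFn_toLp,
    Lp.coeFn_smul (((n : ℂ) * I)⁻¹) (fourierLp 2 n - fourierLp 2 0 : L2T),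
    Lp.coeFn_sub (fourierLp 2 n : L2T) (fourierLp 2 0),
    coeFn_fourierLp (T := 2 * Real.pi) 2 n, coeFn_fourierLp (T := 2 * Real.pi) 2 0]
    with x h1 h2 h3 h4 h5
  rw [charPrimitive, h1, h2, Pi.smul_apply, h3, Pi.sub_apply, h4, h5, charPrimitiveFun,
    fourier_eq_exp_angle, fourier_zero, smul_eq_mul, eq_inv_mul_iff_mul_eq₀ hn']
  have : ∀ t : ℝ, exp (n * t * I) = exp (((n : ℂ) * I) * t) := fun t => by ring_nf
  simp only [this]
  rw [integral_exp_mul_complex hn']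
  simp
  field_simp

/-- The `m`-th Fourier coefficient, as a continuous linear functional on `L²(𝕋)`. -/
noncomputable def fourierFunctional (m : ℤ) : L2T →L[ℂ] ℂ := innerSL ℂ (fourierLp 2 m)

theorem fourierFunctional_fourierLp (m n : ℤ) :
    fourierFunctional m (fourierLp 2 n) = if m = n then 1 else 0 :=
  orthonormal_iff_ite.1 orthonormal_fourier m n

theorem fourierFunctional_charPrimitive_zero {m : ℤ} (hm : m ≠ 0) :
    fourierFunctional m (charPrimitive 0) = -((m : ℂ) * I)⁻¹ := by
  have hm' : (m : ℂ) ≠ 0 := by exact_mod_cast hm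
  have h1 : fourierFunctional m (charPrimitive 0) = fourierCoeff (charPrimitive 0) m := by
    rw [← fourierBasis_repr, HilbertBasis.repr_apply_apply, coe_fourierBasis]; rfl
  have h2 : fourierCoeff (charPrimitive 0) m = fourierCoeff (fun x : 𝕋 => (angle x : ℂ)) m := by
    refine integral_congr_ae ?_
    filter_upwards [(memLp_charPrimitiveFun 0).coeFn_toLp] with x hx
    rw [charPrimitive, hx]
    simp [charPrimitiveFun]
  rw [h1, h2, fourierCoeff_eq_intervalIntegral _ _ 0, zero_add]
  have h3 : ∫ x in (0 : ℝ)..2 * Real.pi, fourier (-m) (x : 𝕋) • (angle (x : 𝕋) : ℂ) =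
      ∫ x in (0 : ℝ)..2 * Real.pi, exp (-(m * I) * x) * x := by
    refine intervalIntegral.integral_congr_ae ?_
    have : ∀ᵐ x : ℝ, x ≠ 2 * Real.pi := by simp [ae_iff]
    filter_upwards [this] with x hx hm
    rw [Set.uIoc_of_le Real.two_pi_pos.le] at hm
    rw [fourier_eq_exp_angle, angle_coe_of_mem ⟨hm.1.le, lt_of_le_of_ne hm.2 hx⟩, smul_eq_mul]
    push_cast
    ring_nf
  have h4 : ∀ t : ℝ, HasDerivAt (fun s : ℝ => exp (-(m * I) * s) * (s * (I / m) + 1 / m ^ 2))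
      (exp (-(m * I) * t) * t) t := fun t => by
    have ho : HasDerivAt (fun s : ℝ => (s : ℂ)) 1 t := Complex.ofRealCLM.hasDerivAt
    refine ((ho.const_mul (-(m * I))).cexp.mul
      ((ho.mul_const (I / m)).add_const (1 / (m : ℂ) ^ 2))).congr_deriv ?_
    field_simp
    linear_combination (-t * m : ℂ) * I_sq
  have h5 := intervalIntegral.integral_eq_sub_of_hasDerivAt (fun t _ => h4 t)
    ((by fun_prop : Continuous fun t : ℝ => exp (-(m * I) * t) * (t : ℂ)).intervalIntegrable 0
      (2 * Real.pi))
  have h6 : exp (-(m * I) * ((2 * Real.pi : ℝ) : ℂ)) = 1 := by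
    have : -((m : ℂ) * I) * ((2 * Real.pi : ℝ) : ℂ) = ((-m : ℤ) : ℂ) * (2 * Real.pi * I) := by
      push_cast; ring
    rw [this, exp_int_mul_two_pi_mul_I]
  rw [h3, h5, h6]
  have hpi : (Real.pi : ℂ) ≠ 0 := by exact_mod_cast Real.pi_ne_zero
  rw [Complex.real_smul]
  push_cast
  simp only [mul_zero, Complex.exp_zero, zero_mul]
  field_simp
  linear_combination (2 * Real.pi * m : ℂ) * I_sq

/-- The vectors `w n`, differences of consecutive primitives of characters; the Kalish operator maps
each of them to the next one. The vector `w n` is the integral over `α ∈ [0, 2π]` of `e^{inα}` times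
the eigenvector `(1 - e^{iα}) 1_{(α, 2π)}` for the eigenvalue `e^{iα}`; the factor `1 - e^{iα}`
removes the jump of the eigenvectorfield at `1` and makes the series `∑ b n • w n` converge for
every bounded `b`. -/
noncomputable def shiftVector (n : ℤ) : L2T := charPrimitive n - charPrimitive (n + 1)

theorem kalishOperator_shiftVector (n : ℤ) :
    kalishOperator (shiftVector n) = shiftVector (n + 1) := by
  simp only [shiftVector, map_sub, kalishOperator_charPrimitive]

theorem fourierFunctional_charPrimitive {m : ℤ} (hm : m ≠ 0) (n : ℤ) :
    fourierFunctional m (charPrimitive n) =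
      ((m : ℂ) * I)⁻¹ * ((if n = m then 1 else 0) - (if n = 0 then 1 else 0)) := by
  rcases eq_or_ne n 0 with rfl | hn
  · simp [fourierFunctional_charPrimitive_zero hm, hm.symm]
  · rw [charPrimitive_eq hn, map_smul, map_sub, fourierFunctional_fourierLp,
      fourierFunctional_fourierLp]
    rcases eq_or_ne m n with rfl | h
    · simp [hm]
    · simp [h, h.symm, hn, hm]

/-- A functional that reads off second differences of the coefficients of `∑ b n • w n`: its value
there is `(b m - b (m - 1)) - (b 0 - b (-1))`. -/
noncomputable def differenceFunctional (m : ℤ) : L2T →L[ℂ] ℂ :=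
  ((m : ℂ) * I) • fourierFunctional m

theorem differenceFunctional_shiftVector (m n : ℤ) :
    differenceFunctional m (shiftVector n) =
      ((if n = m then 1 else 0) - (if n = m - 1 then 1 else 0)) -
        ((if n = 0 then 1 else 0) - (if n = -1 then 1 else 0)) := by
  rcases eq_or_ne m 0 with rfl | hm
  · simp [differenceFunctional]
  · have hm' : (m : ℂ) * I ≠ 0 := mul_ne_zero (by exact_mod_cast hm) I_ne_zero
    simp only [differenceFunctional, shiftVector, _root_.smul_apply, map_sub,
      fourierFunctional_charPrimitive hm, smul_eq_mul, eq_sub_iff_add_eq.symm,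
      eq_neg_iff_add_eq_zero]
    rw [mul_inv_cancel_left₀ hm', mul_inv_cancel_left₀ hm', zero_sub]
    ring

/-- If `f` is orthogonal to all `shiftVector n`, then `⟪charPrimitive n, f⟫` does not depend on `n`,
and as it tends to `0` it vanishes; so all Fourier coefficients of `f` are equal, hence zero. -/
theorem span_shiftVector_dense :
    Dense (Submodule.span ℂ (Set.range shiftVector) : Set L2T) := by
  rw [Submodule.dense_iff_topologicalClosure_eq_top,
    Submodule.topologicalClosure_eq_top_iff, Submodule.eq_bot_iff]
  intro f hf
  have h0 : ∀ n, inner ℂ (shiftVector n) f = 0 := fun n =>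
    (Submodule.mem_orthogonal _ f).1 hf _ (Submodule.subset_span ⟨n, rfl⟩)
  have h1 : ∀ n, inner ℂ (charPrimitive (n + 1)) f = inner ℂ (charPrimitive n) f := fun n => by
    have := h0 n
    rw [shiftVector, inner_sub_left, sub_eq_zero] at this
    exact this.symm
  have h2 : ∀ n : ℤ, inner ℂ (charPrimitive n) f = inner ℂ (charPrimitive 0) f := fun n => by
    induction n using Int.induction_on with
    | zero => rfl
    | succ i ih => rw [h1, ih]
    | pred i ih => rw [← ih, ← h1, sub_add_cancel]
  have h3 : ∀ n : ℤ, n ≠ 0 → inner ℂ (charPrimitive 0) f =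
      (starRingEnd ℂ) ((n : ℂ) * I)⁻¹ * (inner ℂ (fourierLp 2 n) f - inner ℂ (fourierLp 2 0) f) := by
    intro n hn
    rw [← h2 n, charPrimitive_eq hn, inner_smul_left, inner_sub_left]
  have h4 : inner ℂ (charPrimitive 0) f = 0 := by
    have hb : ∀ n : ℕ, ‖inner ℂ (charPrimitive 0) f‖ ≤ (2 * ‖f‖) * (1 / ((n : ℝ) + 1)) := by
      intro n
      have hn : ((n : ℤ) + 1) ≠ 0 := by omega
      rw [h3 _ hn, norm_mul, RCLike.norm_conj, mul_comm]
      have e1 : ‖((((n : ℤ) + 1 : ℤ) : ℂ) * I)⁻¹‖ = 1 / ((n : ℝ) + 1) := by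
        rw [norm_inv, norm_mul, norm_I, mul_one, one_div]
        congr 1
        have : ((((n : ℤ) + 1 : ℤ)) : ℂ) = (((n : ℝ) + 1 : ℝ) : ℂ) := by push_cast; ring
        rw [this, Complex.norm_of_nonneg (by positivity)]
      rw [e1]
      gcongr
      refine (norm_sub_le _ _).trans ?_
      have e2 : ∀ k : ℤ, ‖inner ℂ (fourierLp 2 k : L2T) f‖ ≤ ‖f‖ := fun k => by
        have := norm_inner_le_norm (𝕜 := ℂ) (fourierLp 2 k : L2T) f
        rwa [orthonormal_fourier.1 k, one_mul] at this
      linarith [e2 (n + 1), e2 0]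
    have hl := (tendsto_one_div_add_atTop_nhds_zero_nat (𝕜 := ℝ)).const_mul (2 * ‖f‖)
    rw [mul_zero] at hl
    exact norm_le_zero_iff.1 (ge_of_tendsto' hl hb)
  have h5 : ∀ n : ℤ, inner ℂ (fourierLp 2 n) f = inner ℂ (fourierLp 2 0) f := fun n => by
    rcases eq_or_ne n 0 with rfl | hn
    · rfl
    · have := h3 n hn
      have hn' : (n : ℂ) * I ≠ 0 := mul_ne_zero (by exact_mod_cast hn) I_ne_zero
      rw [h4, eq_comm, mul_eq_zero, map_eq_zero, inv_eq_zero, sub_eq_zero] at this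
      exact this.resolve_left hn'
  have h6 := (orthonormal_fourier (T := 2 * Real.pi)).inner_products_summable (x := f)
  simp only [h5] at h6
  have h7 : inner ℂ (fourierLp 2 0) f = 0 := by
    have := (summable_const_iff (β := ℤ) (a := ‖inner ℂ (fourierLp 2 0) f‖ ^ 2)).1 h6
    simpa using this
  refine (map_eq_zero_iff (fourierBasis (T := 2 * Real.pi)).repr
    (LinearIsometryEquiv.injective _)).1 ?_
  ext n
  rw [HilbertBasis.repr_apply_apply, coe_fourierBasis, h5, h7]
  rfl

end Primitives

/-! ### Bessel families -/

section Bessel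

variable {ι Z : Type*} [NormedAddCommGroup Z] [NormedSpace ℂ Z]

/-- A family `v` of vectors is Bessel with respect to the weight `ρ` if finite linear combinations
`∑ b i • v i` are bounded, up to a constant, by the norm of `b` in `ℓ²(ρ)`. -/
def IsBesselFamily (ρ : ι → ℝ) (v : ι → Z) : Prop :=
  ∃ C : ℝ, 0 ≤ C ∧ ∀ (s : Finset ι) (b : ι → ℂ),
    ‖∑ i ∈ s, b i • v i‖ ≤ C * √(∑ i ∈ s, ρ i * ‖b i‖ ^ 2)

theorem IsBesselFamily.add {ρ : ι → ℝ} {v w : ι → Z} (hv : IsBesselFamily ρ v)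
    (hw : IsBesselFamily ρ w) : IsBesselFamily ρ (fun i => v i + w i) := by
  obtain ⟨C, hC, h⟩ := hv
  obtain ⟨D, hD, h'⟩ := hw
  refine ⟨C + D, add_nonneg hC hD, fun s b => ?_⟩
  simp only [smul_add, Finset.sum_add_distrib, add_mul]
  exact (norm_add_le _ _).trans (add_le_add (h s b) (h' s b))

theorem isBesselFamily_smul_const {ρ : ι → ℝ} (hρ : ∀ i, 0 ≤ ρ i) (hsum : Summable ρ)
    {κ : ι → ℂ} {K : ℝ} (hκ : ∀ i, ‖κ i‖ ≤ K * ρ i) (y : Z) :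
    IsBesselFamily ρ (fun i => κ i • y) := by
  refine ⟨|K| * √(∑' i, ρ i) * ‖y‖, by positivity, fun s b => ?_⟩
  have h1 : ‖∑ i ∈ s, b i • κ i • y‖ ≤ (∑ i ∈ s, ‖b i‖ * (|K| * ρ i)) * ‖y‖ := by
    rw [Finset.sum_mul]
    refine norm_sum_le_of_le _ fun i _ => ?_
    rw [norm_smul, norm_smul, ← mul_assoc]
    gcongr
    exact (hκ i).trans (mul_le_mul_of_nonneg_right (le_abs_self K) (hρ i))
  have h2 : ∑ i ∈ s, ‖b i‖ * ρ i ≤ √(∑ i ∈ s, ρ i) * √(∑ i ∈ s, ρ i * ‖b i‖ ^ 2) := by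
    refine (le_of_eq ?_).trans ((Finset.sum_le_sum fun i _ => le_rfl).trans
      (Real.sum_sqrt_mul_sqrt_le s hρ fun i => mul_nonneg (hρ i) (sq_nonneg ‖b i‖)))
    refine Finset.sum_congr rfl fun i _ => ?_
    rw [Real.sqrt_mul (hρ i), Real.sqrt_sq (norm_nonneg _), ← mul_assoc, Real.mul_self_sqrt (hρ i),
      mul_comm]
  have h3 : √(∑ i ∈ s, ρ i) ≤ √(∑' i, ρ i) :=
    Real.sqrt_le_sqrt (hsum.sum_le_tsum s fun i _ => hρ i)
  calc _ ≤ _ := h1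
    _ = |K| * (∑ i ∈ s, ‖b i‖ * ρ i) * ‖y‖ := by
        rw [Finset.mul_sum]; congr 1; exact Finset.sum_congr rfl fun i _ => by ring
    _ ≤ |K| * (√(∑' i, ρ i) * √(∑ i ∈ s, ρ i * ‖b i‖ ^ 2)) * ‖y‖ := by
        gcongr; exact h2.trans (by gcongr)
    _ = _ := by ring

theorem isBesselFamily_smul_orthonormal {Z : Type*} [NormedAddCommGroup Z] [InnerProductSpace ℂ Z]
    {ρ : ι → ℝ} {e : ι → Z} (he : Orthonormal ℂ e)
    {c : ι → ℂ} {K : ℝ} (hK : 0 ≤ K) (hc : ∀ i, ‖c i‖ ^ 2 ≤ K * ρ i) :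
    IsBesselFamily ρ (fun i => c i • e i) := by
  refine ⟨√K, Real.sqrt_nonneg _, fun s b => ?_⟩
  rw [← Real.sqrt_mul hK]
  refine Real.le_sqrt_of_sq_le ?_
  have h1 : ‖∑ i ∈ s, b i • c i • e i‖ ^ 2 = ∑ i ∈ s, ‖b i * c i‖ ^ 2 := by
    simp only [smul_smul]
    have h := he.inner_sum (fun i => b i * c i) (fun i => b i * c i) s
    rw [inner_self_eq_norm_sq_to_K] at h
    simp only [RCLike.conj_mul] at h
    exact_mod_cast h
  rw [h1, Finset.mul_sum]
  refine Finset.sum_le_sum fun i _ => ?_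
  rw [norm_mul, mul_pow]
  nlinarith [hc i, sq_nonneg ‖b i‖]

end Bessel

section ShiftedSequence

open Complex

/-- The weight `1 / (1 + n²)`. -/
noncomputable def quadraticWeight (n : ℤ) : ℝ := 1 / (1 + (n : ℝ) ^ 2)

theorem quadraticWeight_nonneg (n : ℤ) : 0 ≤ quadraticWeight n := by
  unfold quadraticWeight; positivity

theorem summable_quadraticWeight : Summable quadraticWeight := by
  refine Summable.of_norm_bounded_eventually
    ((Real.summable_one_div_int_pow (p := 2)).2 one_lt_two) ?_
  filter_upwards [(Set.finite_singleton (0 : ℤ)).compl_mem_cofinite] with n hn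
  have hn' : (n : ℝ) ≠ 0 := by exact_mod_cast hn
  rw [Real.norm_of_nonneg (quadraticWeight_nonneg n)]
  exact one_div_le_one_div_of_le (by positivity) (by linarith)

theorem norm_inv_int_mul_I_sq_le (n : ℤ) :
    ‖((n : ℂ) * I)⁻¹‖ ^ 2 ≤ 2 * quadraticWeight n := by
  rcases eq_or_ne n 0 with rfl | hn
  · simp [quadraticWeight]
  have h1 : (1 : ℝ) ≤ (n : ℝ) ^ 2 := by
    have : (1 : ℤ) ≤ n ^ 2 := by have := sq_pos_of_ne_zero hn; omega
    exact_mod_cast this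
  rw [norm_inv, norm_mul, norm_I, mul_one, norm_intCast, inv_pow, sq_abs, quadraticWeight,
    mul_one_div, inv_eq_one_div, div_le_div_iff₀ (by positivity) (by positivity)]
  linarith

theorem quadraticWeight_succ_le (n : ℤ) : quadraticWeight (n + 1) ≤ 3 * quadraticWeight n := by
  rw [quadraticWeight, quadraticWeight, mul_one_div,
    div_le_div_iff₀ (by positivity) (by positivity)]
  push_cast
  nlinarith [sq_nonneg (2 * (n : ℝ) + 3)]

theorem norm_inv_int_mul_I_sub_le (n : ℤ) :
    ‖((n : ℂ) * I)⁻¹ - (((n + 1 : ℤ) : ℂ) * I)⁻¹‖ ≤ 3 * quadraticWeight n := by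
  rcases eq_or_ne n 0 with rfl | hn
  · simp [quadraticWeight]
  rcases eq_or_ne n (-1) with rfl | hn1
  · simp [quadraticWeight]; norm_num
  have hn' : (n : ℂ) ≠ 0 := by exact_mod_cast hn
  have hs : n + 1 ≠ 0 := by omega
  have hs' : ((n + 1 : ℤ) : ℂ) ≠ 0 := by exact_mod_cast hs
  have h1 : ((n : ℂ) * I)⁻¹ - (((n + 1 : ℤ) : ℂ) * I)⁻¹ = (((n * (n + 1) : ℤ) : ℂ) * I)⁻¹ := by
    push_cast at hs' ⊢
    field_simp
    ring
  have h2 : (1 : ℤ) + n ^ 2 ≤ 3 * (n * (n + 1)) := by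
    rcases lt_or_gt_of_ne hn with h | h
    · nlinarith [show n + 2 ≤ 0 by omega]
    · nlinarith
  have h3 : (1 : ℝ) + n ^ 2 ≤ 3 * ((n * (n + 1) : ℤ) : ℝ) := by exact_mod_cast h2
  have h4 : (0 : ℝ) < ((n * (n + 1) : ℤ) : ℝ) := by nlinarith [sq_nonneg (n : ℝ)]
  rw [h1, norm_inv, norm_mul, norm_I, mul_one, norm_intCast, abs_of_pos h4, quadraticWeight,
    mul_one_div, inv_eq_one_div, div_le_div_iff₀ h4 (by positivity)]
  linarith

/-- The vectors `shiftVector n` are combinations of two orthonormal sequences with coefficients of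
size `1 / |n|`, up to an error of size `1 / n²` in the plane spanned by two fixed vectors. -/
theorem shiftVector_eq (n : ℤ) : shiftVector n =
    ((((n : ℂ) * I)⁻¹ • fourierLp 2 n + (-(((n + 1 : ℤ) : ℂ) * I)⁻¹) • fourierLp 2 (n + 1)) +
      (-(((n : ℂ) * I)⁻¹ - (((n + 1 : ℤ) : ℂ) * I)⁻¹)) • fourierLp 2 0) +
      ((if n = 0 then 1 else 0) - (if n + 1 = 0 then 1 else 0) : ℂ) • charPrimitive 0 := by
  have h : ∀ k : ℤ, charPrimitive k = ((k : ℂ) * I)⁻¹ • (fourierLp 2 k - fourierLp 2 0 : L2T) +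
      (if k = 0 then 1 else 0 : ℂ) • charPrimitive 0 := fun k => by
    rcases eq_or_ne k 0 with rfl | hk
    · simp
    · simp [charPrimitive_eq hk, hk]
  rw [shiftVector, h n, h (n + 1)]
  module

theorem isBesselFamily_shiftVector : IsBesselFamily quadraticWeight shiftVector := by
  have h : shiftVector = _ := funext shiftVector_eq
  rw [h]
  have ho := orthonormal_fourier (T := 2 * Real.pi)
  refine (((isBesselFamily_smul_orthonormal ho zero_le_two norm_inv_int_mul_I_sq_le).add
    (isBesselFamily_smul_orthonormal (K := 6) (e := fun n : ℤ => fourierLp 2 (n + 1))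
      (ho.comp _ (add_left_injective 1)) (by norm_num) fun n => ?_)).add
    (isBesselFamily_smul_const (K := 3) quadraticWeight_nonneg summable_quadraticWeight
      (fun n => ?_) _)).add
    (isBesselFamily_smul_const (K := 2) quadraticWeight_nonneg summable_quadraticWeight
      (fun n => ?_) _)
  · rw [norm_neg]
    linarith [norm_inv_int_mul_I_sq_le (n + 1), quadraticWeight_succ_le n]
  · rw [norm_neg]
    exact norm_inv_int_mul_I_sub_le n
  · rcases eq_or_ne n 0 with rfl | hn
    · simp [quadraticWeight]
    rcases eq_or_ne n (-1) with rfl | hn1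
    · simp [quadraticWeight]; norm_num
    have : n + 1 ≠ 0 := by omega
    simpa [hn, this] using quadraticWeight_nonneg n

end ShiftedSequence

/-! ### Automorphisms of standard probability spaces -/

section Dynamics

variable {X : Type*} [MeasurableSpace X]

/-- A system that is invertible up to null sets agrees almost everywhere with a measure-preserving
bimeasurable bijection. -/
theorem IsInvertibleSystem.exists_measurableEquiv [StandardBorelSpace X] {μ : Measure X}
    {T : X → X} (h : IsInvertibleSystem T μ) :
    ∃ e : X ≃ᵐ X, MeasurePreserving e μ μ ∧ T =ᵐ[μ] e := by
  classical
  obtain ⟨hT, S, hS, hST, hTS⟩ := h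
  set G₀ : Set X := {x | S (T x) = x ∧ T (S x) = x} with hG₀
  have hG₀m : MeasurableSet G₀ :=
    (measurableSet_eq_fun (hS.measurable.comp hT.measurable) measurable_id).inter
      (measurableSet_eq_fun (hT.measurable.comp hS.measurable) measurable_id)
  have hG₀ae : ∀ᵐ x ∂μ, x ∈ G₀ := by filter_upwards [hST, hTS] with x h1 h2 using ⟨h1, h2⟩
  set G : Set X := {x | ∀ n : ℕ, T^[n] x ∈ G₀ ∧ S^[n] x ∈ G₀} with hG
  have hGm : MeasurableSet G := by
    rw [hG, Set.ofPred_forall]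
    exact MeasurableSet.iInter fun n =>
      ((hT.measurable.iterate n) hG₀m).inter ((hS.measurable.iterate n) hG₀m)
  have hGae : ∀ᵐ x ∂μ, x ∈ G := by
    refine ae_all_iff.2 fun n => ?_
    filter_upwards [(hT.iterate n).quasiMeasurePreserving.ae hG₀ae,
      (hS.iterate n).quasiMeasurePreserving.ae hG₀ae] with x h1 h2 using ⟨h1, h2⟩
  have hTG : ∀ x ∈ G, T x ∈ G := fun x hx n => by
    refine ⟨by simpa using (hx (n + 1)).1, ?_⟩
    cases n with
    | zero => simpa using (hx 1).1
    | succ n =>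
      rw [Function.iterate_succ_apply, show S (T x) = x from (hx 0).1.1]
      exact (hx n).2
  have hSG : ∀ x ∈ G, S x ∈ G := fun x hx n => by
    refine ⟨?_, by simpa using (hx (n + 1)).2⟩
    cases n with
    | zero => simpa using (hx 1).2
    | succ n =>
      rw [Function.iterate_succ_apply, show T (S x) = x from (hx 0).1.2]
      exact (hx n).1
  let e : X ≃ᵐ X :=
    { toFun := fun x => if x ∈ G then T x else x
      invFun := fun x => if x ∈ G then S x else x
      left_inv := fun x => by
        by_cases hx : x ∈ G
        · simp only [if_pos hx, if_pos (hTG x hx)]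
          exact (hx 0).1.1
        · simp only [if_neg hx]
      right_inv := fun x => by
        by_cases hx : x ∈ G
        · simp only [if_pos hx, if_pos (hSG x hx)]
          exact (hx 0).1.2
        · simp only [if_neg hx]
      measurable_toFun := Measurable.ite hGm hT.measurable measurable_id
      measurable_invFun := Measurable.ite hGm hS.measurable measurable_id }
  have he : T =ᵐ[μ] e := by
    filter_upwards [hGae] with x hx
    exact (if_pos hx).symm
  refine ⟨e, ⟨e.measurable, ?_⟩, he⟩
  rw [← Measure.map_congr he, hT.map_eq]

theorem Ergodic.congr_ae {μ : Measure X} {T S : X → X} (hT : Ergodic T μ)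
    (hS : MeasurePreserving S μ μ) (h : T =ᵐ[μ] S) : Ergodic S μ := by
  refine ⟨hS, ⟨fun s hs hinv => ?_⟩⟩
  refine hT.quasiErgodic.aeconst_set₀ hs.nullMeasurableSet ?_
  refine EventuallyEq.trans ?_ (EventuallyEq.of_eq hinv)
  filter_upwards [h] with x hx
  exact congrArg (fun y => s y) hx

/-- The integer iterates of a bijection. -/
def iter (e : X ≃ᵐ X) (n : ℤ) : X → X := ⇑((e.toEquiv : Equiv.Perm X) ^ n)

variable (e : X ≃ᵐ X)

theorem iter_zero (x : X) : iter e 0 x = x := rfl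

theorem iter_one (x : X) : iter e 1 x = e x := by
  simp [iter]

theorem iter_add (m n : ℤ) (x : X) : iter e (m + n) x = iter e m (iter e n x) := by
  simp [iter, zpow_add]

theorem iter_natCast (n : ℕ) (x : X) : iter e n x = e^[n] x := by
  rw [iter, zpow_natCast, ← Equiv.Perm.iterate_eq_pow]
  rfl

theorem iter_neg_natCast (n : ℕ) (x : X) : iter e (-n) x = e.symm^[n] x := by
  rw [iter, ← inv_zpow', zpow_natCast, ← Equiv.Perm.iterate_eq_pow]
  rfl

theorem iter_neg_eq_iff {n : ℤ} {x y : X} : iter e (-n) x = y ↔ x = iter e n y := by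
  rw [iter, zpow_neg, Equiv.Perm.inv_eq_iff_eq, iter]

variable {e}

theorem measurePreserving_iter {μ : Measure X} (he : MeasurePreserving e μ μ) (n : ℤ) :
    MeasurePreserving (iter e n) μ μ := by
  obtain ⟨k, rfl | rfl⟩ := n.eq_nat_or_neg
  · rw [funext (iter_natCast e k)]
    exact he.iterate k
  · rw [funext (iter_neg_natCast e k)]
    exact (he.symm e).iterate k

/-- An ergodic automorphism of an atomless standard probability space is aperiodic: if
`e ^ k = id` on a set of full measure, then the maximum over an orbit of an injective function is
almost everywhere constant, so that almost all orbits meet one point. -/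
theorem Ergodic.ae_iter_ne [StandardBorelSpace X] {μ : Measure X} [IsProbabilityMeasure μ]
    (hμ : ∀ x : X, μ {x} = 0) (he : Ergodic e μ) {n : ℤ} (hn : n ≠ 0) :
    ∀ᵐ x ∂μ, iter e n x ≠ x := by
  have key : ∀ k : ℕ, ∀ᵐ x ∂μ, iter e (k + 1 : ℕ) x ≠ x := by
    intro k
    set P : Set X := {x | iter e (k + 1 : ℕ) x = x} with hP
    have hPm : MeasurableSet P := measurableSet_eq_fun
      (measurePreserving_iter he.toMeasurePreserving _).measurable measurable_id
    have hPinv : e ⁻¹' P = P := by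
      ext x
      simp only [hP, Set.mem_preimage, Set.mem_ofPred_eq]
      rw [← iter_one e x, ← iter_add, add_comm, iter_add, iter_one, iter_one]
      exact e.injective.eq_iff
    rcases he.toPreErgodic.ae_mem_or_ae_notMem hPm hPinv with h | h
    swap
    · exact h
    exfalso
    have ht := measurableEmbedding_embeddingReal X
    set t := embeddingReal X
    let g : X → ℝ := fun x => (Finset.range (k + 1)).sup' ⟨0, by simp⟩ fun j => t (iter e j x)
    have hg : Measurable g := Finset.measurable_range_sup'' fun j _ =>
      ht.measurable.comp (measurePreserving_iter he.toMeasurePreserving j).measurable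
    have hle : ∀ (x : X) {j : ℕ}, j < k + 1 → t (iter e j x) ≤ g x := fun x j hj =>
      Finset.le_sup' (fun j : ℕ => t (iter e j x)) (Finset.mem_range.2 hj)
    have hsup : ∀ (x : X) {a : ℝ}, (∀ j : ℕ, j < k + 1 → t (iter e j x) ≤ a) → g x ≤ a :=
      fun x a h => Finset.sup'_le _ _ fun j hj => h j (Finset.mem_range.1 hj)
    have hge : g ∘ e =ᵐ[μ] g := by
      filter_upwards [h] with x hx
      have hx' : iter e (k + 1 : ℕ) x = x := hx
      have hs : ∀ j : ℕ, iter e j (e x) = iter e (j + 1 : ℕ) x := fun j => by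
        rw [← iter_one e x, ← iter_add]; norm_cast
      refine le_antisymm (hsup _ fun j hj => ?_) (hsup _ fun j hj => ?_)
      · rw [hs]
        rcases Nat.lt_or_ge (j + 1) (k + 1) with h1 | h1
        · exact hle x h1
        · rw [show j + 1 = k + 1 by omega, hx']
          exact hle x (j := 0) (Nat.succ_pos k)
      · cases j with
        | zero =>
          have := hle (e x) (Nat.lt_succ_self k)
          rwa [hs, hx'] at this
        | succ j =>
          rw [← hs]
          exact hle (e x) (by omega)
    obtain ⟨c, hc⟩ := he.ae_eq_const_of_ae_eq_comp_ae hg.aestronglyMeasurable hge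
    have hnull : ∀ j : ℕ, ∀ᵐ x ∂μ, t (iter e j x) ≠ c := fun j => by
      refine (measurePreserving_iter he.toMeasurePreserving j).quasiMeasurePreserving.ae
        (p := fun y => t y ≠ c) ?_
      rw [ae_iff]
      have hsub : {y | ¬ t y ≠ c}.Subsingleton := fun x hx y hy =>
        ht.injective ((not_not.1 hx).trans (not_not.1 hy).symm)
      rcases hsub.eq_empty_or_singleton with h0 | ⟨y, hy⟩
      · rw [h0, measure_empty]
      · rw [hy, hμ]
    have : ∀ᵐ x ∂μ, False := by
      filter_upwards [ae_all_iff.2 hnull, hc] with x h1 h2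
      obtain ⟨j, -, hj⟩ := Finset.exists_mem_eq_sup' (s := Finset.range (k + 1)) ⟨0, by simp⟩
        fun j : ℕ => t (iter e j x)
      exact h1 j (hj.symm.trans h2)
    rw [eventually_false_iff_eq_bot, ae_eq_bot] at this
    exact IsProbabilityMeasure.ne_zero μ this
  obtain ⟨k, rfl | rfl⟩ := n.eq_nat_or_neg
  · obtain ⟨j, rfl⟩ := Nat.exists_eq_succ_of_ne_zero (by simpa using hn)
    exact key j
  · obtain ⟨j, rfl⟩ := Nat.exists_eq_succ_of_ne_zero (by simpa using hn)
    filter_upwards [key j] with x hx h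
    exact hx ((iter_neg_eq_iff e).1 h).symm

/-- An aperiodic system has a set of positive measure no point of which returns within time `K`. A
set of positive measure without this property is split according to whether a rational number
separates the values of a Borel injection at `x` and at `e ^ (K + 1) x`. -/
theorem exists_disjoint_iterates [StandardBorelSpace X] {μ : Measure X} [IsProbabilityMeasure μ]
    (he : MeasurePreserving e μ μ) (hap : ∀ n : ℤ, n ≠ 0 → ∀ᵐ x ∂μ, iter e n x ≠ x) (K : ℕ) :
    ∃ B : Set X, MeasurableSet B ∧ μ B ≠ 0 ∧
      ∀ j : ℕ, j ≠ 0 → j ≤ K → ∀ x ∈ B, iter e j x ∉ B := by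
  induction K with
  | zero => exact ⟨Set.univ, MeasurableSet.univ, by simp, fun j h0 h1 => absurd h1 (by omega)⟩
  | succ K ih =>
    obtain ⟨B, hB, hB0, hd⟩ := ih
    have ht := measurableEmbedding_embeddingReal X
    set t := embeddingReal X
    set r : X → ℝ := fun x => t (iter e (K + 1 : ℕ) x) with hr
    have hrm : Measurable r := ht.measurable.comp (measurePreserving_iter he _).measurable
    by_contra hcon
    push Not at hcon
    have hsmall : ∀ C : Set X, MeasurableSet C → C ⊆ B →
        (∀ x ∈ C, iter e (K + 1 : ℕ) x ∉ C) → μ C = 0 := by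
      intro C hC hCB hCd
      by_contra h0
      obtain ⟨j, hj0, hjK, x, hx, hx'⟩ := hcon C hC h0
      rcases Nat.lt_or_ge j (K + 1) with h | h
      · exact hd j hj0 (by omega) x (hCB hx) (hCB hx')
      · rw [show j = K + 1 by omega] at hx'
        exact hCd x hx hx'
    have h1 : ∀ q : ℚ, μ (B ∩ ({x | t x < q} ∩ {x | (q : ℝ) < r x})) = 0 := fun q => by
      refine hsmall _ (hB.inter ((measurableSet_lt ht.measurable measurable_const).inter
        (measurableSet_lt measurable_const hrm))) Set.inter_subset_left ?_
      rintro x ⟨-, -, hx⟩ ⟨-, hx', -⟩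
      have h1 : (q : ℝ) < r x := hx
      have h2 : r x < q := hx'
      exact lt_asymm h1 h2
    have h2 : ∀ q : ℚ, μ (B ∩ ({x | (q : ℝ) < t x} ∩ {x | r x < q})) = 0 := fun q => by
      refine hsmall _ (hB.inter ((measurableSet_lt measurable_const ht.measurable).inter
        (measurableSet_lt hrm measurable_const))) Set.inter_subset_left ?_
      rintro x ⟨-, -, hx⟩ ⟨-, hx', -⟩
      have h1 : r x < q := hx
      have h2 : (q : ℝ) < r x := hx'
      exact lt_asymm h1 h2
    refine hB0 (measure_mono_null (fun x hx => ?_)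
      (measure_union_null (measure_union_null (measure_iUnion_null h1) (measure_iUnion_null h2))
        (ae_iff.1 (hap (K + 1 : ℕ) (by omega)))))
    by_cases hfix : iter e (K + 1 : ℕ) x = x
    · exact Or.inr (not_not.2 hfix)
    · have hne : t x ≠ r x := fun h => hfix (ht.injective h).symm
      rcases lt_or_gt_of_ne hne with h | h
      · obtain ⟨q, hq1, hq2⟩ := exists_rat_btwn h
        exact Or.inl (Or.inl (Set.mem_iUnion.2 ⟨q, hx, hq1, hq2⟩))
      · obtain ⟨q, hq1, hq2⟩ := exists_rat_btwn h
        exact Or.inl (Or.inr (Set.mem_iUnion.2 ⟨q, hx, hq2, hq1⟩))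

/-- In an aperiodic system there are bases `B` of positive but arbitrarily small measure for towers
of any given height: a point of `B` returns to `B` at no time `0 < |n| ≤ N`. -/
theorem exists_tower_base [StandardBorelSpace X] {μ : Measure X} [IsProbabilityMeasure μ]
    (he : MeasurePreserving e μ μ) (hap : ∀ n : ℤ, n ≠ 0 → ∀ᵐ x ∂μ, iter e n x ≠ x) (N : ℕ)
    {δ : ENNReal} (hδ : δ ≠ 0) :
    ∃ B : Set X, MeasurableSet B ∧ μ B ≠ 0 ∧ μ B ≤ δ ∧
      ∀ n : ℤ, n ≠ 0 → |n| ≤ N → ∀ x ∈ B, iter e n x ∉ B := by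
  obtain ⟨M, hM⟩ := ENNReal.exists_inv_nat_lt hδ
  obtain ⟨B, hB, hB0, hd⟩ := exists_disjoint_iterates he hap (max N M)
  refine ⟨B, hB, hB0, ?_, fun n hn hnN x hx hx' => ?_⟩
  · refine le_trans ?_ hM.le
    have hdisj : Pairwise fun i j : Fin M =>
        Disjoint (iter e (i : ℕ) ⁻¹' B) (iter e (j : ℕ) ⁻¹' B) := by
      have aux : ∀ i j : Fin M, i < j →
          Disjoint (iter e (i : ℕ) ⁻¹' B) (iter e (j : ℕ) ⁻¹' B) := fun i j hij => by
        refine Set.disjoint_left.2 fun x hx hx' => ?_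
        have hlt : (i : ℕ) < j := hij
        refine hd (j - i : ℕ) (by omega) (by have := j.2; omega) _ hx ?_
        rw [← iter_add]
        have : ((j - i : ℕ) : ℤ) + (i : ℕ) = (j : ℕ) := by omega
        rw [this]
        exact hx'
      intro i j hij
      rcases lt_or_gt_of_ne hij with h | h
      · exact aux i j h
      · exact (aux j i h).symm
    have hle : ∑ i : Fin M, μ (iter e (i : ℕ) ⁻¹' B) ≤ 1 := by
      rw [← tsum_fintype (L := SummationFilter.unconditional _), ← measure_iUnion hdisj fun i =>
        (measurePreserving_iter he _).measurable hB]
      exact prob_le_one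
    simp only [(measurePreserving_iter he _).measure_preimage hB.nullMeasurableSet,
      Finset.sum_const, Finset.card_univ, Fintype.card_fin, nsmul_eq_mul] at hle
    rw [ENNReal.le_inv_iff_mul_le, mul_comm]
    exact hle
  · have habs : n.natAbs ≤ max N M := le_max_of_le_left (by
      rw [Int.abs_eq_natAbs] at hnN; exact_mod_cast hnN)
    rcases le_total 0 n with h | h
    · refine hd n.natAbs (by omega) habs x hx ?_
      rwa [Int.natAbs_of_nonneg h]
    · refine hd n.natAbs (by omega) habs _ hx' ?_
      rw [← iter_add, Int.ofNat_natAbs_of_nonpos h, neg_add_cancel]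
      exact hx

end Dynamics

/-! ### The coding operator -/

section Coding

variable {X : Type*} [MeasurableSpace X] {μ : Measure X}

theorem Lp.enorm_sq_eq_lintegral {E : Type*} [NormedAddCommGroup E] (F : Lp E 2 μ) :
    ‖F‖ₑ ^ 2 = ∫⁻ x, ‖F x‖ₑ ^ 2 ∂μ := by
  have h := eLpNorm_nnreal_pow_eq_lintegral (f := F) (μ := μ) (p := 2) two_ne_zero
  rw [Lp.enorm_def]
  simpa using h

variable {Z : Type*} [NormedAddCommGroup Z] [NormedSpace ℂ Z] {e : X ≃ᵐ X}
  (he : MeasurePreserving e μ μ) (w : ℤ → Z)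

/-- The operator sending `f ∈ L²(μ)` to the vector-valued function `x ↦ f (e⁻ⁿ x) • w n`. -/
noncomputable def codingTerm (n : ℤ) : Lp ℂ 2 μ →L[ℂ] Lp Z 2 μ :=
  ((ContinuousLinearMap.toSpanSingleton ℂ (w n)).compLpL 2 μ).comp
    (Lp.compMeasurePreservingₗᵢ ℂ (iter e (-n))
      (measurePreserving_iter he (-n))).toContinuousLinearMap

theorem coeFn_codingTerm (n : ℤ) (f : Lp ℂ 2 μ) :
    codingTerm he w n f =ᵐ[μ] fun x => f (iter e (-n) x) • w n := by
  have h1 := (ContinuousLinearMap.toSpanSingleton ℂ (w n)).coeFn_compLp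
    (Lp.compMeasurePreserving (iter e (-n)) (measurePreserving_iter he (-n)) f)
  have h2 := Lp.coeFn_compMeasurePreserving f (measurePreserving_iter he (-n))
  filter_upwards [h1, h2] with x hx1 hx2
  refine hx1.trans ?_
  rw [hx2, ContinuousLinearMap.toSpanSingleton_apply, Function.comp_apply]

theorem coeFn_sum_codingTerm (s : Finset ℤ) (f : Lp ℂ 2 μ) :
    (∑ n ∈ s, codingTerm he w n f : Lp Z 2 μ) =ᵐ[μ] fun x => ∑ n ∈ s, f (iter e (-n) x) • w n := by
  have h := ae_all_iff.2 fun n => coeFn_codingTerm he w n f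
  filter_upwards [h, Lp.coeFn_finsetSum s fun n => codingTerm he w n f] with x hx hs
  rw [hs, Finset.sum_apply]
  exact Finset.sum_congr rfl fun n _ => hx n

variable {w} {ρ : ℤ → ℝ}

theorem norm_sum_codingTerm_le (hρ : ∀ n, 0 ≤ ρ n) {C : ℝ} (hC : 0 ≤ C)
    (hb : ∀ (s : Finset ℤ) (b : ℤ → ℂ), ‖∑ i ∈ s, b i • w i‖ ≤ C * √(∑ i ∈ s, ρ i * ‖b i‖ ^ 2))
    (s : Finset ℤ) : ‖∑ n ∈ s, codingTerm he w n‖ ≤ C * √(∑ n ∈ s, ρ n) := by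
  have hs0 : 0 ≤ ∑ n ∈ s, ρ n := Finset.sum_nonneg fun n _ => hρ n
  refine ContinuousLinearMap.opNorm_le_bound _ (by positivity) fun f => ?_
  rw [_root_.sum_apply]
  have h1 : ‖∑ n ∈ s, codingTerm he w n f‖ₑ ^ 2 ≤
      ENNReal.ofReal (C ^ 2 * ∑ n ∈ s, ρ n) * ‖f‖ₑ ^ 2 := by
    rw [Lp.enorm_sq_eq_lintegral]
    calc ∫⁻ x, ‖(∑ n ∈ s, codingTerm he w n f : Lp Z 2 μ) x‖ₑ ^ 2 ∂μ
        ≤ ∫⁻ x, ENNReal.ofReal (C ^ 2) *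
          ∑ n ∈ s, ENNReal.ofReal (ρ n) * ‖f (iter e (-n) x)‖ₑ ^ 2 ∂μ := by
          refine lintegral_mono_ae ?_
          filter_upwards [coeFn_sum_codingTerm he w s f] with x hx
          rw [hx]
          have h := hb s fun n => f (iter e (-n) x)
          have h' : ‖∑ n ∈ s, f (iter e (-n) x) • w n‖ ^ 2 ≤
              C ^ 2 * ∑ n ∈ s, ρ n * ‖f (iter e (-n) x)‖ ^ 2 := by
            refine (pow_le_pow_left₀ (norm_nonneg _) h 2).trans_eq ?_
            rw [mul_pow, Real.sq_sqrt (Finset.sum_nonneg fun n _ =>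
              mul_nonneg (hρ n) (sq_nonneg _))]
          simp only [← ofReal_norm]
          rw [← ENNReal.ofReal_pow (norm_nonneg _)]
          refine (ENNReal.ofReal_le_ofReal h').trans_eq ?_
          rw [ENNReal.ofReal_mul (sq_nonneg C), ENNReal.ofReal_sum_of_nonneg fun n _ =>
            mul_nonneg (hρ n) (sq_nonneg _)]
          congr 1
          refine Finset.sum_congr rfl fun n _ => ?_
          rw [ENNReal.ofReal_mul (hρ n), ENNReal.ofReal_pow (norm_nonneg _)]
      _ = ENNReal.ofReal (C ^ 2) * ∑ n ∈ s, ENNReal.ofReal (ρ n) * ‖f‖ₑ ^ 2 := by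
          have hm : ∀ n, AEMeasurable (fun x => ‖f (iter e (-n) x)‖ₑ ^ 2) μ := fun n =>
            ((Lp.aestronglyMeasurable f).enorm.pow_const 2).comp_quasiMeasurePreserving
              (measurePreserving_iter he (-n)).quasiMeasurePreserving
          rw [lintegral_const_mul'' _ (Finset.aemeasurable_fun_sum _ fun n _ =>
            (hm n).const_mul _), lintegral_finsetSum' _ fun n _ => (hm n).const_mul _]
          congr 1
          refine Finset.sum_congr rfl fun n _ => ?_
          rw [lintegral_const_mul'' _ (hm n), Lp.enorm_sq_eq_lintegral f]
          have hmp := measurePreserving_iter he (-n)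
          have hg : AEMeasurable (fun x => ‖f x‖ₑ ^ 2) μ :=
            (Lp.aestronglyMeasurable f).enorm.pow_const 2
          have h := lintegral_map' (μ := μ) (f := fun x => ‖f x‖ₑ ^ 2)
            (by rwa [hmp.map_eq]) hmp.measurable.aemeasurable
          rw [hmp.map_eq] at h
          rw [h]
      _ = _ := by
          rw [← Finset.sum_mul, ← ENNReal.ofReal_sum_of_nonneg fun n _ => hρ n, ← mul_assoc,
            ← ENNReal.ofReal_mul (sq_nonneg C)]
  simp only [← ofReal_norm] at h1
  rw [← ENNReal.ofReal_pow (norm_nonneg _), ← ENNReal.ofReal_pow (norm_nonneg _),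
    ← ENNReal.ofReal_mul (by positivity), ENNReal.ofReal_le_ofReal_iff (by positivity)] at h1
  refine le_of_sq_le_sq ?_ (by positivity)
  refine h1.trans_eq ?_
  rw [mul_pow, mul_pow, Real.sq_sqrt hs0]

theorem summable_codingTerm [CompleteSpace Z] (hρ : ∀ n, 0 ≤ ρ n) (hsum : Summable ρ)
    (hw : IsBesselFamily ρ w) : Summable (codingTerm he w) := by
  obtain ⟨C, hC, hb⟩ := hw
  rw [summable_iff_vanishing_norm]
  intro ε hε
  obtain ⟨s, hs⟩ := summable_iff_vanishing_norm.1 hsum ((ε / (C + 1)) ^ 2) (by positivity)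
  refine ⟨s, fun t ht => (norm_sum_codingTerm_le he hρ hC hb t).trans_lt ?_⟩
  have h1 := (le_abs_self _).trans_lt (hs t ht)
  have h2 : √(∑ n ∈ t, ρ n) < ε / (C + 1) := (Real.sqrt_lt' (by positivity)).2 h1
  calc C * √(∑ n ∈ t, ρ n) ≤ (C + 1) * √(∑ n ∈ t, ρ n) := by gcongr; linarith
    _ < (C + 1) * (ε / (C + 1)) := by gcongr
    _ = ε := by field_simp

variable (w) in
/-- The coding operator `f ↦ (x ↦ ∑ f (e⁻ⁿ x) • w n)` from `L²(μ)` to `L²(μ; Z)`. It makes sense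
when `w` is Bessel for a summable weight, the series then converging in operator norm. -/
noncomputable def coding : Lp ℂ 2 μ →L[ℂ] Lp Z 2 μ := ∑' n, codingTerm he w n

variable (hs : Summable (codingTerm he w))
include hs

theorem hasSum_coding (f : Lp ℂ 2 μ) : HasSum (fun n => codingTerm he w n f) (coding he w f) :=
  hs.hasSum.mapL (ContinuousLinearMap.apply ℂ (Lp Z 2 μ) f)

/-- If `A` shifts the family `w`, then the coding intertwines `e` with `A`. -/
theorem coding_comp_ae_eq {A : Z →L[ℂ] Z} (hA : ∀ n, A (w n) = w (n + 1)) (f : Lp ℂ 2 μ) :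
    ∀ᵐ x ∂μ, coding he w f (e x) = A (coding he w f x) := by
  have h1 := (hasSum_coding he hs f).mapL (A.compLpL 2 μ)
  have h2 := (hasSum_coding he hs f).mapL
    (Lp.compMeasurePreservingₗᵢ ℂ e he).toContinuousLinearMap
  have h3 : ∀ n, A.compLpL 2 μ (codingTerm he w n f) =
      (Lp.compMeasurePreservingₗᵢ ℂ e he).toContinuousLinearMap (codingTerm he w (n + 1) f) := by
    intro n
    refine Lp.ext ?_
    filter_upwards [A.coeFn_compLp (codingTerm he w n f), coeFn_codingTerm he w n f,
      Lp.coeFn_compMeasurePreserving (codingTerm he w (n + 1) f) he,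
      he.quasiMeasurePreserving.ae (coeFn_codingTerm he w (n + 1) f)] with x a1 a2 a3 a4
    refine a1.trans (Eq.trans ?_ a3.symm)
    rw [Function.comp_apply, a4, a2, map_smul, hA, ← iter_one e x, ← iter_add]
    congr 3
    ring
  have h4 := (Equiv.addRight (1 : ℤ)).hasSum_iff.2 h2
  have h5 : A.compLpL 2 μ (coding he w f) =
      (Lp.compMeasurePreservingₗᵢ ℂ e he).toContinuousLinearMap (coding he w f) := by
    refine h1.unique ?_
    convert h4 using 1
    ext1 n
    exact h3 n
  filter_upwards [A.coeFn_compLp (coding he w f),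
    Lp.coeFn_compMeasurePreserving (coding he w f) he] with x a1 a2
  rw [← a1]
  refine a2.symm.trans ?_
  exact (congrArg (fun F : Lp Z 2 μ => F x) h5).symm

/-- A functional that annihilates all but finitely many of the `w n` reads off finitely many
values of `f` along the orbit of `x`. -/
theorem functional_coding_ae_eq (l : Z →L[ℂ] ℂ) {s : Finset ℤ} (hl : ∀ n ∉ s, l (w n) = 0)
    (f : Lp ℂ 2 μ) :
    ∀ᵐ x ∂μ, l (coding he w f x) = ∑ n ∈ s, f (iter e (-n) x) * l (w n) := by
  have h1 := (hasSum_coding he hs f).mapL (l.compLpL 2 μ)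
  have h2 : ∀ n ∉ s, l.compLpL 2 μ (codingTerm he w n f) = 0 := fun n hn => by
    refine Lp.ext ?_
    filter_upwards [l.coeFn_compLp (codingTerm he w n f), coeFn_codingTerm he w n f,
      Lp.coeFn_zero ℂ 2 μ] with x a1 a2 a3
    refine a1.trans ?_
    rw [a2, a3, map_smul, hl n hn, smul_zero, Pi.zero_apply]
  have h3 := h1.unique (hasSum_sum_of_ne_finset_zero h2)
  rw [← map_sum] at h3
  filter_upwards [l.coeFn_compLp (coding he w f), coeFn_sum_codingTerm he w s f,
    l.coeFn_compLp (∑ n ∈ s, codingTerm he w n f)] with x a1 a2 a3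
  rw [← a1]
  refine (congrArg (fun F : Lp ℂ 2 μ => F x) h3).trans (a3.trans ?_)
  rw [a2, map_sum]
  exact Finset.sum_congr rfl fun n _ => by rw [map_smul, smul_eq_mul]

/-- Where the part of the coding series over a finite set `s` has the value `v`, the coding of a
bounded function is as close to `v` as the Bessel bound allows for the remaining terms. -/
theorem norm_coding_sub_le {C R r : ℝ} (hC : 0 ≤ C) (hρ : ∀ n, 0 ≤ ρ n)
    (hb : ∀ (s : Finset ℤ) (b : ℤ → ℂ), ‖∑ i ∈ s, b i • w i‖ ≤ C * √(∑ i ∈ s, ρ i * ‖b i‖ ^ 2))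
    {s : Finset ℤ} (hr : ∀ t : Finset ℤ, Disjoint t s → C * (R * √(∑ n ∈ t, ρ n)) ≤ r)
    {f : Lp ℂ 2 μ} (hR : 0 ≤ R) (hf : ∀ᵐ x ∂μ, ‖f x‖ ≤ R) {B : Set X} {v : Z}
    (hB : ∀ᵐ x ∂μ, x ∈ B → ∑ n ∈ s, f (iter e (-n) x) • w n = v) :
    ∀ᵐ x ∂μ, x ∈ B → ‖coding he w f x - v‖ ≤ r := by
  have h1 : Tendsto (fun t : Finset ℤ => eLpNorm
      (⇑(∑ n ∈ t, codingTerm he w n f : Lp Z 2 μ) - ⇑(coding he w f)) 2 μ) atTop (𝓝 0) :=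
    (Lp.tendsto_Lp_iff_tendsto_eLpNorm' _ _).1 (hasSum_coding he hs f)
  obtain ⟨ns, hns, hlim⟩ := (tendstoInMeasure_of_tendsto_eLpNorm two_ne_zero
    (fun t => Lp.aestronglyMeasurable _) (Lp.aestronglyMeasurable _) h1).exists_seq_tendsto_ae'
  have hf' := ae_all_iff.2 fun n => (measurePreserving_iter he (-n)).quasiMeasurePreserving.ae hf
  filter_upwards [hlim, hB, hf', ae_all_iff.2 fun t => coeFn_sum_codingTerm he w t f]
    with x hx hxB hxf hxt hxmem
  refine le_of_tendsto (hx.sub_const v).norm ?_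
  filter_upwards [hns.eventually (eventually_ge_atTop s)] with k hk
  rw [hxt, ← Finset.sum_sdiff hk, hxB hxmem, add_sub_cancel_right]
  refine le_trans ((hb _ _).trans ?_) (hr (ns k \ s) Finset.sdiff_disjoint)
  refine mul_le_mul_of_nonneg_left (Real.sqrt_le_iff.2 ⟨by positivity, ?_⟩) hC
  rw [mul_pow, Real.sq_sqrt (Finset.sum_nonneg fun n _ => hρ n), Finset.mul_sum]
  refine Finset.sum_le_sum fun n _ => ?_
  rw [mul_comm]
  exact mul_le_mul_of_nonneg_right (pow_le_pow_left₀ (norm_nonneg _) (hxf n) 2) (hρ n)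

end Coding

/-! ### Codings that charge open sets -/

section Baire

variable {X : Type*} [MeasurableSpace X] {μ : Measure X}
variable {Z : Type*} [NormedAddCommGroup Z]

theorem Lp.exists_subseq_tendsto_ae {F : ℕ → Lp Z 2 μ} {G : Lp Z 2 μ}
    (h : Tendsto F atTop (𝓝 G)) :
    ∃ ns : ℕ → ℕ, StrictMono ns ∧ ∀ᵐ x ∂μ, Tendsto (fun k => F (ns k) x) atTop (𝓝 (G x)) :=
  (tendstoInMeasure_of_tendsto_eLpNorm two_ne_zero (fun _ => Lp.aestronglyMeasurable _)
    (Lp.aestronglyMeasurable _)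
    ((Lp.tendsto_Lp_iff_tendsto_eLpNorm' _ _).1 h)).exists_seq_tendsto_ae

theorem isOpen_setOf_not_ae_notMem {U : Set Z} (hU : IsOpen U) :
    IsOpen {F : Lp Z 2 μ | ¬ ∀ᵐ x ∂μ, F x ∉ U} := by
  rw [← isClosed_compl_iff]
  refine IsSeqClosed.isClosed fun F G hF hG => ?_
  obtain ⟨ns, -, hns⟩ := Lp.exists_subseq_tendsto_ae hG
  have hF' : ∀ k, ∀ᵐ x ∂μ, F k x ∉ U := fun k => not_not.1 (hF k)
  refine not_not.2 ?_
  filter_upwards [hns, ae_all_iff.2 hF'] with x hx hx'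
  exact hU.isClosed_compl.mem_of_tendsto hx (Eventually.of_forall fun k => hx' (ns k))

theorem isOpen_setOf_lintegral_lt [IsFiniteMeasure μ] (k : BoundedContinuousFunction Z ℝ)
    {t : X → ℝ} (ht : Measurable t) {c : ℝ} (hc : ∀ x, ‖t x‖ ≤ c) (δ : ENNReal) :
    IsOpen {F : Lp Z 2 μ | ∫⁻ x, ‖k (F x) - t x‖ₑ ∂μ < δ} := by
  rw [← isClosed_compl_iff]
  refine IsSeqClosed.isClosed fun F G hF hG => ?_
  obtain ⟨ns, -, hns⟩ := Lp.exists_subseq_tendsto_ae hG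
  have hF' : ∀ j, δ ≤ ∫⁻ x, ‖k (F j x) - t x‖ₑ ∂μ := fun j => not_lt.1 (hF j)
  refine (not_lt.2 ?_ : ¬ ∫⁻ x, ‖k (G x) - t x‖ₑ ∂μ < δ)
  have hlim : Tendsto (fun j => ∫⁻ x, ‖k (F (ns j) x) - t x‖ₑ ∂μ) atTop
      (𝓝 (∫⁻ x, ‖k (G x) - t x‖ₑ ∂μ)) := by
    refine tendsto_lintegral_of_dominated_convergence' (fun _ => ENNReal.ofReal (‖k‖ + c))
      (fun j => ?_) (fun j => ?_) ?_ ?_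
    · exact ((k.continuous.comp_aestronglyMeasurable (Lp.aestronglyMeasurable _)).sub
        ht.aestronglyMeasurable).enorm
    · filter_upwards with x
      rw [← ofReal_norm]
      exact ENNReal.ofReal_le_ofReal
        ((norm_sub_le _ _).trans (add_le_add (k.norm_coe_le_norm _) (hc x)))
    · rw [lintegral_const]
      exact ENNReal.mul_ne_top ENNReal.ofReal_ne_top (measure_ne_top _ _)
    · filter_upwards [hns] with x hx
      exact (((k.continuous.tendsto _).comp hx).sub_const _).enorm
  exact ge_of_tendsto' hlim fun j => hF' (ns j)

theorem Lp.exists_simpleFunc_dist_lt [IsFiniteMeasure μ] (f : Lp Z 2 μ) {ε : ℝ} (hε : 0 < ε) :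
    ∃ (s : SimpleFunc X Z) (hs : MemLp s 2 μ), dist (hs.toLp s) f < ε := by
  obtain ⟨s, hs, hsm⟩ := (Lp.memLp f).exists_simpleFunc_eLpNorm_sub_lt (by norm_num)
    (ε := ENNReal.ofReal ε) (by simpa using hε)
  refine ⟨s, hsm, ?_⟩
  rw [dist_comm, Lp.dist_def, ← ENNReal.lt_ofReal_iff_toReal_lt]
  · refine lt_of_eq_of_lt (eLpNorm_congr_ae ?_) hs
    filter_upwards [hsm.coeFn_toLp] with x hx
    simp [hx]
  · exact ((Lp.memLp _).sub (Lp.memLp _)).2.ne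

variable [NormedSpace ℂ Z] {e : X ≃ᵐ X} (he : MeasurePreserving e μ μ) {w : ℤ → Z} {ρ : ℤ → ℝ}

/-- The codings that charge a given non-empty open set are dense: a simple function can be changed
on a tower of small measure, so that the coding is close to a prescribed linear combination of the
`w n` on the base of the tower. -/
theorem dense_setOf_coding_charges [StandardBorelSpace X] [IsProbabilityMeasure μ]
    [CompleteSpace Z]
    (hap : ∀ n : ℤ, n ≠ 0 → ∀ᵐ x ∂μ, iter e n x ≠ x)
    (hρ : ∀ n, 0 ≤ ρ n) (hsum : Summable ρ) (hw : IsBesselFamily ρ w)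
    (hspan : Dense (Submodule.span ℂ (Set.range w) : Set Z))
    {U : Set Z} (hU : IsOpen U) (hne : U.Nonempty) :
    Dense {f : Lp ℂ 2 μ | ¬ ∀ᵐ x ∂μ, coding he w f x ∉ U} := by
  classical
  have hs := summable_codingTerm he hρ hsum hw
  obtain ⟨C, hC, hb⟩ := hw
  obtain ⟨v, hvs, hvU⟩ := hspan.exists_mem_open hU hne
  obtain ⟨a, rfl⟩ := Finsupp.mem_span_range_iff_exists_finsupp.1 hvs
  obtain ⟨r, hr, hball⟩ := Metric.isOpen_iff.1 hU _ hvU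
  refine Metric.dense_iff.2 fun f ε hε => ?_
  obtain ⟨s, hsm, hsf⟩ := Lp.exists_simpleFunc_dist_lt f (half_pos hε)
  obtain ⟨R₁, hR₁⟩ := s.exists_forall_norm_le
  set R : ℝ := max R₁ (∑ n ∈ a.support, ‖a n‖) with hRdef
  have hsR : ∀ x, ‖s x‖ ≤ R := fun x => (hR₁ x).trans (le_max_left _ _)
  have haR : ∀ n, ‖a n‖ ≤ R := fun n => by
    refine le_trans ?_ (le_max_right _ _)
    by_cases hn : n ∈ a.support
    · exact Finset.single_le_sum (f := fun n => ‖a n‖) (fun _ _ => norm_nonneg _) hn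
    · rw [Finsupp.notMem_support_iff.1 hn, norm_zero]
      exact Finset.sum_nonneg fun _ _ => norm_nonneg _
  have hR : 0 ≤ R := (norm_nonneg _).trans (haR 0)
  -- The terms of index `|n| > N` contribute at most `r / 2` to the coding of any function
  -- bounded by `R`.
  obtain ⟨s₀, hs₀⟩ := summable_iff_vanishing_norm.1 hsum ((r / 2 / (C * R + 1)) ^ 2) (by positivity)
  obtain ⟨N, hN⟩ : ∃ N : ℕ, s₀ ∪ a.support ⊆ Finset.Icc (-N : ℤ) N := by
    refine ⟨(s₀ ∪ a.support).sup Int.natAbs, fun n hn => ?_⟩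
    have : n.natAbs ≤ (s₀ ∪ a.support).sup Int.natAbs := Finset.le_sup (f := Int.natAbs) hn
    rw [Finset.mem_Icc]
    omega
  set I : Finset ℤ := Finset.Icc (-N : ℤ) N with hI
  have htail : ∀ t : Finset ℤ, Disjoint t I → C * (R * √(∑ n ∈ t, ρ n)) ≤ r / 2 := by
    intro t ht
    have h1 := (le_abs_self _).trans_lt (hs₀ t
      (Finset.disjoint_of_subset_right (Finset.subset_union_left.trans hN) ht))
    have h2 : √(∑ n ∈ t, ρ n) < r / 2 / (C * R + 1) := (Real.sqrt_lt' (by positivity)).2 h1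
    calc C * (R * √(∑ n ∈ t, ρ n)) ≤ (C * R + 1) * √(∑ n ∈ t, ρ n) := by
          nlinarith [Real.sqrt_nonneg (∑ n ∈ t, ρ n)]
      _ ≤ (C * R + 1) * (r / 2 / (C * R + 1)) := by gcongr
      _ = r / 2 := by field_simp
  set q : ℝ := ε / 2 / (2 * R + 1) with hq
  have hq0 : 0 < q := by positivity
  obtain ⟨B, hB, hB0, hBδ, hBd⟩ := exists_tower_base he hap (2 * N)
    (δ := ENNReal.ofReal (q ^ 2 / I.card.succ)) (by
      rw [Ne, ENNReal.ofReal_eq_zero, not_le]; positivity)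
  -- The levels of the tower over `B` of index in `I` are disjoint.
  have hBd' : ∀ n ∈ I, ∀ m ∈ I, ∀ y, iter e n y ∈ B → iter e m y ∈ B → n = m := by
    intro n hn m hm y hny hmy
    by_contra hne
    rw [hI, Finset.mem_Icc] at hn hm
    refine hBd (m - n) (sub_ne_zero.2 (Ne.symm hne)) ?_ _ hny ?_
    · rw [abs_le]; push_cast; omega
    · rwa [← iter_add, sub_add_cancel]
  -- On the level of index `n` the value is changed to `a n`.
  let g : X → ℂ := fun y => s y + ∑ n ∈ I, (iter e n ⁻¹' B).indicator (fun y => a n - s y) y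
  have hgm : Measurable g := s.measurable.add (Finset.measurable_fun_sum _ fun n _ =>
    (measurable_const.sub s.measurable).indicator
      ((measurePreserving_iter he n).measurable hB))
  have hg1 : ∀ n ∈ I, ∀ y, iter e n y ∈ B → g y = a n := by
    intro n hn y hy
    have h : ∑ m ∈ I, (iter e m ⁻¹' B).indicator (fun y => a m - s y) y = a n - s y := by
      rw [Finset.sum_eq_single_of_mem n hn]
      · exact Set.indicator_of_mem (s := iter e n ⁻¹' B) hy _
      · intro m hm hmn
        exact Set.indicator_of_notMem (s := iter e m ⁻¹' B)
          (fun hmy => hmn (hBd' m hm n hn y hmy hy)) _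
    simp only [g, h]
    ring
  set W : Set X := ⋃ n ∈ I, iter e n ⁻¹' B with hW
  have hWm : MeasurableSet W := Finset.measurableSet_biUnion _ fun n _ =>
    (measurePreserving_iter he n).measurable hB
  have hg2 : ∀ y ∉ W, g y = s y := by
    intro y hy
    have h : ∑ m ∈ I, (iter e m ⁻¹' B).indicator (fun y => a m - s y) y = 0 :=
      Finset.sum_eq_zero fun m hm => Set.indicator_of_notMem
        (fun hmy => hy (Set.mem_biUnion hm hmy)) _
    simp only [g, h, add_zero]
  have hgR : ∀ y, ‖g y‖ ≤ R := fun y => by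
    by_cases hy : y ∈ W
    · obtain ⟨n, hn, hny⟩ := Set.mem_iUnion₂.1 hy
      rw [hg1 n hn y hny]
      exact haR n
    · rw [hg2 y hy]
      exact hsR y
  have hgL : MemLp g 2 μ :=
    MemLp.of_bound hgm.aestronglyMeasurable R (Eventually.of_forall hgR)
  have hWμ : μ W ≤ ENNReal.ofReal (q ^ 2) := by
    refine (measure_biUnion_finset_le _ _).trans ?_
    simp only [(measurePreserving_iter he _).measure_preimage hB.nullMeasurableSet,
      Finset.sum_const, nsmul_eq_mul]
    calc (I.card : ENNReal) * μ B ≤ I.card * ENNReal.ofReal (q ^ 2 / I.card.succ) := by gcongr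
      _ = ENNReal.ofReal (I.card * (q ^ 2 / I.card.succ)) := by
          rw [ENNReal.ofReal_mul (by positivity), ENNReal.ofReal_natCast]
      _ ≤ ENNReal.ofReal (q ^ 2) := by
          refine ENNReal.ofReal_le_ofReal ?_
          rw [mul_div_assoc', div_le_iff₀ (by positivity), mul_comm]
          gcongr
          exact Nat.le_succ _
  have hdist : dist (hgL.toLp g) (hsm.toLp s) < ε / 2 := by
    rw [Lp.dist_def, ← ENNReal.lt_ofReal_iff_toReal_lt
      (((Lp.memLp _).sub (Lp.memLp _)).2.ne)]
    have h1 : eLpNorm (⇑(hgL.toLp g) - ⇑(hsm.toLp s)) 2 μ ≤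
        eLpNorm (W.indicator fun _ => 2 * R) 2 μ := by
      refine eLpNorm_mono_ae_real ?_
      filter_upwards [hgL.coeFn_toLp, hsm.coeFn_toLp] with y h1 h2
      rw [Pi.sub_apply, h1, h2]
      by_cases hy : y ∈ W
      · rw [Set.indicator_of_mem hy]
        refine (norm_sub_le _ _).trans ?_
        linarith [hgR y, hsR y]
      · rw [Set.indicator_of_notMem hy, hg2 y hy, sub_self, norm_zero]
    refine h1.trans_lt ?_
    rw [eLpNorm_indicator_const hWm two_ne_zero (by norm_num)]
    calc ‖2 * R‖ₑ * μ W ^ (1 / (2 : ENNReal).toReal)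
        ≤ ENNReal.ofReal (2 * R) * ENNReal.ofReal (q ^ 2) ^ (1 / (2 : ENNReal).toReal) := by
          rw [Real.enorm_of_nonneg (by positivity)]
          gcongr
      _ = ENNReal.ofReal (2 * R * q) := by
          rw [ENNReal.ofReal_rpow_of_nonneg (by positivity) (by simp),
            ← ENNReal.ofReal_mul (by positivity)]
          congr 2
          rw [ENNReal.toReal_ofNat, ← Real.sqrt_eq_rpow, Real.sqrt_sq hq0.le]
      _ < ENNReal.ofReal (ε / 2) := by
          rw [ENNReal.ofReal_lt_ofReal_iff (by positivity), hq, mul_div_assoc',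
            div_lt_iff₀ (by positivity)]
          nlinarith
  refine ⟨hgL.toLp g, ?_, fun hcon => hB0 ?_⟩
  · rw [Metric.mem_ball]
    linarith [dist_triangle (hgL.toLp g) (hsm.toLp s) f]
  · have hgae := ae_all_iff.2 fun n =>
      (measurePreserving_iter he (-n)).quasiMeasurePreserving.ae hgL.coeFn_toLp
    have hval : ∀ᵐ x ∂μ, x ∈ B → ∑ n ∈ I, (hgL.toLp g) (iter e (-n) x) • w n =
        a.sum fun n c => c • w n := by
      filter_upwards [hgae] with x hx hxB
      rw [Finsupp.sum_of_support_subset a (Finset.subset_union_right.trans hN) _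
        fun n _ => zero_smul ℂ (w n)]
      refine Finset.sum_congr rfl fun n hn => ?_
      rw [hx n, hg1 n hn]
      rw [← iter_add, add_neg_cancel, iter_zero]
      exact hxB
    have hbound : ∀ᵐ x ∂μ, ‖(hgL.toLp g) x‖ ≤ R := by
      filter_upwards [hgL.coeFn_toLp] with x hx
      rw [hx]
      exact hgR x
    have hfin := norm_coding_sub_le he hs hC hρ hb htail hR hbound hval
    refine measure_mono_null (fun x hx => ?_) (ae_iff.1 (hcon.and hfin))
    rintro ⟨h1, h2⟩
    refine h1 (hball ?_)
    rw [Metric.mem_ball, dist_eq_norm]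
    linarith [h2 hx]

end Baire

/-! ### Codings that can be decoded, and the universality criterion -/

section Decoding

variable {X : Type*} [MeasurableSpace X] {μ : Measure X}
variable {Z : Type*} [NormedAddCommGroup Z] [NormedSpace ℂ Z] [MeasurableSpace Z] [BorelSpace Z]
  [SecondCountableTopology Z]
variable {e : X ≃ᵐ X} (he : MeasurePreserving e μ μ) {w : ℤ → Z}

/-- If `g` is bounded, then the coding of `g` determines the second differences of the values of
`g` along the orbit of a point. Boundedness turns this into knowledge of `g x - g (e x)`, and when
the latter determines `x`, the point `x` can be recovered measurably from its code. -/
theorem exists_measurable_decoding [StandardBorelSpace X]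
    (hs : Summable (codingTerm he w)) {l : ℤ → Z →L[ℂ] ℂ}
    (hl : ∀ m n, l m (w n) = ((if n = m then 1 else 0) - (if n = m - 1 then 1 else 0)) -
      ((if n = 0 then 1 else 0) - (if n = -1 then 1 else 0)))
    (hfix : ∀ᵐ x ∂μ, e x ≠ x) {g : X → ℂ} (hgL : MemLp g 2 μ) {R : ℝ} (hgR : ∀ x, ‖g x‖ ≤ R)
    (hg : ∀ x y, e x ≠ x → g x - g (e x) = g y - g (e y) → x = y)
    {t : X → ℝ} (ht : Measurable t) :
    ∃ h : Z → ℝ, Measurable h ∧ ∀ᵐ x ∂μ, h (coding he w (hgL.toLp g) x) = t x := by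
  classical
  set φ : X → Z := ⇑(coding he w (hgL.toLp g)) with hφ
  have hφm : Measurable φ := (Lp.stronglyMeasurable _).measurable
  have hread : ∀ m : ℤ, ∀ᵐ x ∂μ, l m (φ x) =
      (g (iter e (-m) x) - g (iter e (-(m - 1)) x)) - (g x - g (e x)) := by
    intro m
    have h := functional_coding_ae_eq he hs (l m) (s := {m, m - 1, 0, -1}) (fun n hn => by
      simp only [Finset.mem_insert, Finset.mem_singleton, not_or] at hn
      simp [hl, hn.1, hn.2.1, hn.2.2.1, hn.2.2.2]) (hgL.toLp g)
    have hgae := ae_all_iff.2 fun n =>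
      (measurePreserving_iter he (-n)).quasiMeasurePreserving.ae hgL.coeFn_toLp
    filter_upwards [h, hgae] with x hx hgx
    rw [hφ, hx]
    simp only [hgx, hl, mul_sub, mul_ite, mul_one, mul_zero, Finset.sum_sub_distrib,
      Finset.sum_ite_eq', Finset.mem_insert, Finset.mem_singleton, true_or, or_true, if_true]
    rw [neg_zero, iter_zero, neg_neg, iter_one]
  obtain ⟨X', hX', hX'm, hX'p⟩ := (hfix.and (ae_all_iff.2 hread)).exists_measurable_mem
  have hinj : Set.InjOn φ X' := by
    intro x hx y hy hxy
    obtain ⟨hxf, hxr⟩ := hX'p x hx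
    obtain ⟨hyf, hyr⟩ := hX'p y hy
    refine hg x y hxf ?_
    set D : ℤ → ℂ := fun n => g (iter e (-n) x) - g (iter e (-n) y) with hD
    set c : ℂ := (g x - g (e x)) - (g y - g (e y)) with hc
    -- `D` is an arithmetic progression; being bounded, it is constant.
    have hstep : ∀ m, D m - D (m - 1) = c := fun m => by
      have := (hxr m).symm.trans ((congrArg (l m) hxy).trans (hyr m))
      simp only [hD, hc]
      linear_combination this
    have hlin : ∀ k : ℕ, D k = D 0 + k * c := fun k => by
      induction k with
      | zero => simp
      | succ k ih =>
        have := hstep (k + 1 : ℕ)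
        rw [show ((k + 1 : ℕ) : ℤ) - 1 = k by push_cast; ring, ih] at this
        push_cast at this ⊢
        linear_combination this
    have hDb : ∀ n, ‖D n‖ ≤ 2 * R := fun n =>
      (norm_sub_le _ _).trans (by linarith [hgR (iter e (-n) x), hgR (iter e (-n) y)])
    have hkc : ∀ k : ℕ, k * ‖c‖ ≤ 4 * R := fun k => by
      have h1 : (k : ℂ) * c = D k - D 0 := by rw [hlin k]; ring
      have h2 : ‖(k : ℂ) * c‖ = k * ‖c‖ := by rw [norm_mul, Complex.norm_natCast]
      rw [← h2, h1]
      exact (norm_sub_le _ _).trans (by linarith [hDb k, hDb 0])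
    have hc0 : c = 0 := by
      by_contra hne
      have hpos : 0 < ‖c‖ := norm_pos_iff.2 hne
      obtain ⟨k, hk⟩ := exists_nat_gt (4 * R / ‖c‖)
      rw [div_lt_iff₀ hpos] at hk
      linarith [hkc k]
    exact sub_eq_zero.1 hc0
  have : StandardBorelSpace X' := hX'm.standardBorel
  have hemb : MeasurableEmbedding (fun x : X' => φ x) :=
    (hφm.comp measurable_subtype_coe).measurableEmbedding
      fun x y hxy => Subtype.ext (hinj x.2 y.2 hxy)
  obtain ⟨h, hm, hh⟩ := hemb.exists_measurable_extend (ht.comp measurable_subtype_coe)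
    fun _ => ⟨0⟩
  refine ⟨h, hm, ?_⟩
  filter_upwards [hX'] with x hx
  exact congrFun hh ⟨x, hx⟩

/-- The points `(a, a²)` of the parabola form a Sidon set: a non-zero difference of two of them
determines both. -/
theorem eq_of_parabola_sub_eq {a a' b b' : ℝ} (ha : a ≠ a')
    (h : ((a : ℂ) + (a : ℂ) ^ 2 * Complex.I) - (a' + (a' : ℂ) ^ 2 * Complex.I) =
      (b + (b : ℂ) ^ 2 * Complex.I) - (b' + (b' : ℂ) ^ 2 * Complex.I)) : a = b := by
  have h1 : a - a' = b - b' := by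
    have := congrArg Complex.re h
    simpa [← Complex.ofReal_pow] using this
  have h2 : a ^ 2 - a' ^ 2 = b ^ 2 - b' ^ 2 := by
    have := congrArg Complex.im h
    simpa [← Complex.ofReal_pow] using this
  have h3 : (a - a') * (a + a') = (a - a') * (b + b') := by
    rw [show (a - a') * (a + a') = a ^ 2 - a' ^ 2 by ring, h2, h1]; ring
  have h4 := mul_left_cancel₀ (sub_ne_zero.2 ha) h3
  linarith

/-- Any simple function can be perturbed to a bounded function `g` for which `g x - g (e x)`
determines `x`, by adding a small multiple of an injection into the parabola. -/
theorem exists_perturbation_sub_injective (e : X → X) (s : SimpleFunc X ℂ) {t : X → ℝ}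
    (ht : Measurable t) (hinj : Function.Injective t) (htb : ∀ x, |t x| ≤ 2) {ε : ℝ} (hε : 0 < ε) :
    ∃ g : X → ℂ, Measurable g ∧ (∀ x, ‖g x - s x‖ ≤ ε) ∧
      ∀ x y, e x ≠ x → g x - g (e x) = g y - g (e y) → x = y := by
  set u : X → ℂ := fun x => t x + (t x : ℂ) ^ 2 * Complex.I with hu
  have hum : Measurable u := by fun_prop
  have hub : ∀ x, ‖u x‖ ≤ 6 := fun x => by
    refine (norm_add_le _ _).trans ?_
    rw [norm_mul, Complex.norm_I, mul_one, norm_pow, Complex.norm_real, Real.norm_eq_abs]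
    nlinarith [htb x, abs_nonneg (t x)]
  -- The finitely many values of `(s x - s (e x)) - (s y - s (e y))` are zero or larger than `δ`.
  obtain ⟨δ, hδ, hgap⟩ : ∃ δ : ℝ, 0 < δ ∧ ∀ x y, (s x - s (e x)) - (s y - s (e y)) ≠ 0 →
      δ ≤ ‖(s x - s (e x)) - (s y - s (e y))‖ := by
    have hV := s.finite_range
    have hfin : ((fun p : (ℂ × ℂ) × (ℂ × ℂ) => (p.1.1 - p.1.2) - (p.2.1 - p.2.2)) ''
        ((Set.range s ×ˢ Set.range s) ×ˢ (Set.range s ×ˢ Set.range s)) \ {0}).Finite :=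
      (((hV.prod hV).prod (hV.prod hV)).image _).subset Set.sdiff_subset
    obtain ⟨δ, hδ, hball⟩ := Metric.isOpen_iff.1 hfin.isClosed.isOpen_compl 0
      (fun h => h.2 rfl)
    refine ⟨δ, hδ, fun x y hne => ?_⟩
    by_contra hlt
    refine @hball ((s x - s (e x)) - (s y - s (e y))) ?_ ⟨⟨((s x, s (e x)), (s y, s (e y))),
      ⟨⟨⟨x, rfl⟩, ⟨e x, rfl⟩⟩, ⟨⟨y, rfl⟩, ⟨e y, rfl⟩⟩⟩, rfl⟩, hne⟩
    rw [mem_ball_zero_iff]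
    exact not_le.1 hlt
  set κ : ℝ := min (δ / 25) (ε / 6) with hκ
  have hκ0 : 0 < κ := by positivity
  have hκu : ∀ x, ‖(κ : ℂ) * u x‖ ≤ κ * 6 := fun x => by
    rw [norm_mul, Complex.norm_real, Real.norm_of_nonneg hκ0.le]
    gcongr
    exact hub x
  refine ⟨fun x => s x + κ * u x, s.measurable.add (measurable_const.mul hum), fun x => ?_,
    fun x y hx hxy => ?_⟩
  · rw [add_sub_cancel_left]
    exact (hκu x).trans (by linarith [min_le_right (δ / 25) (ε / 6)])
  · have h1 : (s x - s (e x)) - (s y - s (e y)) =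
        (κ * u y - κ * u (e y)) - (κ * u x - κ * u (e x)) := by linear_combination hxy
    have h2 : ‖(s x - s (e x)) - (s y - s (e y))‖ ≤ κ * 24 := by
      rw [h1]
      refine (norm_sub_le _ _).trans ?_
      have a1 := norm_sub_le ((κ : ℂ) * u y) (κ * u (e y))
      have a2 := norm_sub_le ((κ : ℂ) * u x) (κ * u (e x))
      linarith [hκu x, hκu y, hκu (e x), hκu (e y)]
    have h3 : (s x - s (e x)) - (s y - s (e y)) = 0 := by
      by_contra hne
      have h4 : κ ≤ δ / 25 := min_le_left _ _
      linarith [hgap x y hne]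
    have h5 : u x - u (e x) = u y - u (e y) := by
      refine mul_left_cancel₀ (show (κ : ℂ) ≠ 0 by exact_mod_cast hκ0.ne') ?_
      linear_combination h1 - h3
    exact hinj (eq_of_parabola_sub_eq (fun h => hx (hinj h.symm)) h5)

/-- The codings from which an injection `t` can be approximately recovered by a continuous function
are dense. -/
theorem dense_setOf_coding_decodes [StandardBorelSpace X] [IsProbabilityMeasure μ]
    (hs : Summable (codingTerm he w)) {l : ℤ → Z →L[ℂ] ℂ}
    (hl : ∀ m n, l m (w n) = ((if n = m then 1 else 0) - (if n = m - 1 then 1 else 0)) -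
      ((if n = 0 then 1 else 0) - (if n = -1 then 1 else 0)))
    (hfix : ∀ᵐ x ∂μ, e x ≠ x) {t : X → ℝ} (ht : Measurable t) (hinj : Function.Injective t)
    (htb : ∀ x, |t x| ≤ 2) {δ : ENNReal} (hδ : δ ≠ 0) :
    Dense {f : Lp ℂ 2 μ | ∃ k : BoundedContinuousFunction Z ℝ,
      ∫⁻ x, ‖k (coding he w f x) - t x‖ₑ ∂μ < δ} := by
  refine Metric.dense_iff.2 fun f ε hε => ?_
  obtain ⟨s, hsm, hsf⟩ := Lp.exists_simpleFunc_dist_lt f (half_pos hε)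
  obtain ⟨g, hgm, hgs, hginj⟩ := exists_perturbation_sub_injective e s ht hinj htb
    (show 0 < ε / 3 by positivity)
  obtain ⟨R, hR⟩ := s.exists_forall_norm_le
  have hgR : ∀ x, ‖g x‖ ≤ R + ε / 3 := fun x => by
    have := norm_add_le (s x) (g x - s x)
    rw [add_sub_cancel] at this
    linarith [hR x, hgs x]
  have hgL : MemLp g 2 μ := MemLp.of_bound hgm.aestronglyMeasurable _ (Eventually.of_forall hgR)
  obtain ⟨h, hhm, hh⟩ := exists_measurable_decoding he hs hl hfix hgL hgR hginj ht
  refine ⟨hgL.toLp g, ?_, ?_⟩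
  · have h1 : ‖hgL.toLp g - hsm.toLp s‖ ≤ ε / 3 := by
      have h2 := Lp.norm_le_of_ae_bound (f := hgL.toLp g - hsm.toLp s) (C := ε / 3)
        (by positivity) (by
          filter_upwards [Lp.coeFn_sub (hgL.toLp g) (hsm.toLp s), hgL.coeFn_toLp,
            hsm.coeFn_toLp] with x a1 a2 a3
          rw [a1, Pi.sub_apply, a2, a3]
          exact hgs x)
      have h3 : measureUnivNNReal μ = 1 := by simp [measureUnivNNReal]
      rw [h3] at h2
      simpa using h2
    rw [← dist_eq_norm] at h1
    rw [Metric.mem_ball]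
    linarith [dist_triangle (hgL.toLp g) (hsm.toLp s) f]
  · set φ : X → Z := ⇑(coding he w (hgL.toLp g)) with hφ
    have hφm : Measurable φ := (Lp.stronglyMeasurable _).measurable
    have htL : MemLp t 1 μ := MemLp.of_bound ht.aestronglyMeasurable 2 (Eventually.of_forall htb)
    have hhL : MemLp h 1 (μ.map φ) :=
      (memLp_map_measure_iff hhm.aestronglyMeasurable hφm.aemeasurable).2
        (htL.ae_eq (hh.mono fun x hx => hx.symm))
    have : IsProbabilityMeasure (μ.map φ) := Measure.isProbabilityMeasure_map hφm.aemeasurable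
    obtain ⟨δ', hδ'0, hδ'⟩ := exists_between (pos_iff_ne_zero.2 hδ)
    obtain ⟨k, hk, -⟩ := hhL.exists_boundedContinuous_eLpNorm_sub_le ENNReal.one_ne_top hδ'0.ne'
    refine ⟨k, lt_of_le_of_lt ?_ hδ'⟩
    rw [eLpNorm_one_eq_lintegral_enorm, lintegral_map
      (hhm.sub k.continuous.measurable).enorm hφm] at hk
    refine le_trans (le_of_eq (lintegral_congr_ae ?_)) hk
    filter_upwards [hh] with x hx
    rw [← hx, ← enorm_neg, neg_sub]
    rfl

end Decoding

section Criterion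

universe u'

/-- An operator `A` is universal for invertible ergodic systems as soon as it shifts a two-sided
sequence `w` with dense linear span which is Bessel for a summable weight, and for which the second
differences of the coefficients of `∑ b n • w n` are continuous functionals of the sum. -/
theorem universalForInvertibleErgodicSystems_of_shift {Z : Type*} [NormedAddCommGroup Z]
    [NormedSpace ℂ Z] [CompleteSpace Z] [MeasurableSpace Z] [BorelSpace Z]
    [SecondCountableTopology Z] {A : Z →L[ℂ] Z} {w : ℤ → Z} {ρ : ℤ → ℝ}
    (hA : ∀ n, A (w n) = w (n + 1)) (hρ : ∀ n, 0 ≤ ρ n) (hsum : Summable ρ)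
    (hw : IsBesselFamily ρ w) (hspan : Dense (Submodule.span ℂ (Set.range w) : Set Z))
    {l : ℤ → Z →L[ℂ] ℂ}
    (hl : ∀ m n, l m (w n) = ((if n = m then 1 else 0) - (if n = m - 1 then 1 else 0)) -
      ((if n = 0 then 1 else 0) - (if n = -1 then 1 else 0))) :
    UniversalForInvertibleErgodicSystems.{u'} A := by
  intro X _ _ μ _ T hμ hT hTinv
  obtain ⟨e, he, hTe⟩ := hTinv.exists_measurableEquiv
  have heerg : Ergodic e μ := hT.congr_ae he hTe
  have hap : ∀ n : ℤ, n ≠ 0 → ∀ᵐ x ∂μ, iter e n x ≠ x := fun n hn => heerg.ae_iter_ne hμ hn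
  have hfix : ∀ᵐ x ∂μ, e x ≠ x := by
    simpa only [iter_one] using hap 1 one_ne_zero
  have hs := summable_codingTerm he hρ hsum hw
  have hXne : Nonempty X := nonempty_of_isProbabilityMeasure μ
  -- A bounded Borel injection of `X` into the line.
  obtain ⟨t, htm, htinj, htb⟩ : ∃ t : X → ℝ, Measurable t ∧ Function.Injective t ∧
      ∀ x, |t x| ≤ 2 := by
    have hemb := measurableEmbedding_embeddingReal X
    refine ⟨fun x => Real.arctan (embeddingReal X x), Real.measurable_arctan.comp hemb.measurable,
      Real.arctan_injective.comp hemb.injective, fun x => abs_le.2 ⟨?_, ?_⟩⟩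
    · linarith [Real.neg_pi_div_two_lt_arctan (embeddingReal X x), Real.pi_le_four]
    · linarith [Real.arctan_lt_pi_div_two (embeddingReal X x), Real.pi_le_four]
  -- By the Baire category theorem some `f` charges all open sets and allows decoding of `t`.
  obtain ⟨f, hf1, hf2⟩ : ∃ f : Lp ℂ 2 μ,
      (∀ U ∈ TopologicalSpace.countableBasis Z, ¬ ∀ᵐ x ∂μ, coding he w f x ∉ U) ∧
      ∀ j : ℕ, ∃ k : BoundedContinuousFunction Z ℝ,
        ∫⁻ x, ‖k (coding he w f x) - t x‖ₑ ∂μ < ((j : ENNReal) + 1)⁻¹ := by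
    have hO1 : ∀ U ∈ TopologicalSpace.countableBasis Z,
        IsOpen {f : Lp ℂ 2 μ | ¬ ∀ᵐ x ∂μ, coding he w f x ∉ U} := fun U hU =>
      (isOpen_setOf_not_ae_notMem (TopologicalSpace.isOpen_of_mem_countableBasis hU)).preimage
        (coding he w).continuous
    have hO2 : ∀ j : ℕ, IsOpen {f : Lp ℂ 2 μ | ∃ k : BoundedContinuousFunction Z ℝ,
        ∫⁻ x, ‖k (coding he w f x) - t x‖ₑ ∂μ < ((j : ENNReal) + 1)⁻¹} := fun j => by
      rw [Set.ofPred_exists]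
      exact isOpen_iUnion fun k =>
        (isOpen_setOf_lintegral_lt k htm htb _).preimage (coding he w).continuous
    have hd1 := dense_biInter_of_isOpen hO1 (TopologicalSpace.countable_countableBasis Z)
      fun U hU => dense_setOf_coding_charges he hap hρ hsum hw hspan
        (TopologicalSpace.isOpen_of_mem_countableBasis hU)
        (TopologicalSpace.nonempty_of_mem_countableBasis hU)
    have hd2 := dense_iInter_of_isOpen hO2 fun j =>
      dense_setOf_coding_decodes he hs hl hfix htm htinj htb
        (δ := ((j : ENNReal) + 1)⁻¹) (by simp)
    have hG1 := IsGδ.biInter_of_isOpen (TopologicalSpace.countable_countableBasis Z) hO1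
    obtain ⟨f, hf1, hf2⟩ := (hd1.inter_of_Gδ hG1 (IsGδ.iInter_of_isOpen hO2) hd2).nonempty
    exact ⟨f, fun U hU => Set.mem_iInter₂.1 hf1 U hU, fun j => Set.mem_iInter.1 hf2 j⟩
  set φ : X → Z := ⇑(coding he w f) with hφ
  have hφm : Measurable φ := (Lp.stronglyMeasurable _).measurable
  have hφA : ∀ᵐ x ∂μ, φ (e x) = A (φ x) := coding_comp_ae_eq he hs hA f
  -- A Borel function with `h ∘ φ = t` almost everywhere.
  obtain ⟨h, hhm, hh⟩ : ∃ h : Z → ℝ, Measurable h ∧ ∀ᵐ x ∂μ, h (φ x) = t x := by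
    choose k hk using hf2
    have hlim : Tendsto (fun j => eLpNorm ((fun x => k j (φ x)) - t) 1 μ) atTop (𝓝 0) := by
      refine tendsto_of_tendsto_of_tendsto_of_le_of_le tendsto_const_nhds
        (ENNReal.tendsto_inv_nat_nhds_zero.comp (tendsto_add_atTop_nat 1)) (fun _ => zero_le)
        fun j => ?_
      rw [eLpNorm_one_eq_lintegral_enorm]
      simpa using (hk j).le
    obtain ⟨ns, -, hns⟩ := (tendstoInMeasure_of_tendsto_eLpNorm one_ne_zero
      (fun j => ((k j).continuous.measurable.comp hφm).aestronglyMeasurable)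
      htm.aestronglyMeasurable hlim).exists_seq_tendsto_ae
    refine ⟨fun z => limsup (fun j => k (ns j) z) atTop,
      Measurable.limsup fun j => (k (ns j)).continuous.measurable, ?_⟩
    filter_upwards [hns] with x hx
    exact hx.limsup_eq
  obtain ⟨r, hrm, hr⟩ := (htm.measurableEmbedding htinj).exists_measurable_extend measurable_id
    fun _ => hXne
  set ψ : Z → X := r ∘ h with hψ
  have hψm : Measurable ψ := hrm.comp hhm
  have hψφ : ∀ᵐ x ∂μ, ψ (φ x) = x := by
    filter_upwards [hh] with x hx
    rw [hψ, Function.comp_apply, hx]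
    exact congrFun hr x
  refine ⟨μ.map φ, Measure.isProbabilityMeasure_map hφm.aemeasurable, fun U hU hne => ?_,
    ⟨A.continuous.measurable, ?_⟩, φ, ψ, ⟨hφm, rfl⟩, ⟨hψm, ?_⟩, hψφ, ?_, ?_⟩
  · obtain ⟨z, hz⟩ := hne
    obtain ⟨V, hV, -, hVU⟩ :=
      (TopologicalSpace.isBasis_countableBasis Z).exists_subset_of_mem_open hz hU
    rw [Measure.map_apply hφm hU.measurableSet, pos_iff_ne_zero]
    intro h0
    refine hf1 V hV ?_
    rw [ae_iff]
    simp only [not_not]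
    exact measure_mono_null (fun x hx => hVU hx) h0
  · rw [Measure.map_map A.continuous.measurable hφm]
    have h1 : A ∘ φ =ᵐ[μ] φ ∘ e := hφA.mono fun x hx => hx.symm
    rw [Measure.map_congr h1, ← Measure.map_map hφm he.measurable, he.map_eq]
  · rw [Measure.map_map hψm hφm]
    have h1 : ψ ∘ φ =ᵐ[μ] id := hψφ
    rw [Measure.map_congr h1, Measure.map_id]
  · refine (ae_map_iff (p := fun y => φ (ψ y) = y) hφm.aemeasurable
      (measurableSet_eq_fun (hφm.comp hψm) measurable_id)).2 ?_
    filter_upwards [hψφ] with x hx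
    rw [hx]
  · filter_upwards [hφA, hTe] with x hx hx'
    rw [hx', hx]

end Criterion

theorem kalishOperator_universal.{v} :
    UniversalForInvertibleErgodicSystems.{v} kalishOperator := by
  have := secondCountableTopology_L2T
  exact universalForInvertibleErgodicSystems_of_shift kalishOperator_shiftVector
    quadraticWeight_nonneg summable_quadraticWeight isBesselFamily_shiftVector
    span_shiftVector_dense differenceFunctional_shiftVector

/-! ### Eigenvectors and analytic eigenvectorfields -/

section Eigenvectors

open Complex

/-- The primitive `∫₀^θ i e^{it} f(e^{it}) dt` appearing in the Kalish operator, as a function of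
the real parameter `θ`. -/
noncomputable def kalishPrimitive (f : L2T) (θ : ℝ) : ℂ :=
  ∫ t in (0 : ℝ)..θ, I * exp (t * I) * f (t : 𝕋)

/-- An almost everywhere statement on the circle, in terms of the parameter in `[0, 2π]`. -/
theorem ae_real_of_ae_circle {p : 𝕋 → Prop}
    (h : ∀ᵐ x ∂(AddCircle.haarAddCircle : Measure 𝕋), p x) :
    ∀ᵐ t : ℝ, t ∈ Set.Ioc 0 (2 * Real.pi) → p (t : 𝕋) := by
  have h1 : ∀ᵐ x ∂(volume : Measure 𝕋), p x := by
    rw [AddCircle.volume_eq_smul_haarAddCircle]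
    exact Measure.ae_smul_measure h _
  have h2 := measurePreserving_coe_Ioc.quasiMeasurePreserving.ae h1
  rwa [ae_restrict_iff' measurableSet_Ioc] at h2

theorem ae_circle_of_ae_real {p : 𝕋 → Prop} (hp : MeasurableSet {x | p x})
    (h : ∀ᵐ t : ℝ, t ∈ Set.Ioc 0 (2 * Real.pi) → p (t : 𝕋)) :
    ∀ᵐ x ∂(AddCircle.haarAddCircle : Measure 𝕋), p x := by
  have h1 : ∀ᵐ x ∂(volume : Measure 𝕋), p x := by
    rw [← measurePreserving_coe_Ioc.map_eq,
      ae_map_iff measurePreserving_coe_Ioc.measurable.aemeasurable hp,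
      ae_restrict_iff' measurableSet_Ioc]
    exact h
  rw [AddCircle.volume_eq_smul_haarAddCircle] at h1
  exact (Measure.ae_ennreal_smul_measure_iff
    (by rw [Ne, ENNReal.ofReal_eq_zero, not_le]; exact Real.two_pi_pos)).1 h1

/-- The eigenvalue equation in terms of the angle `t`. -/
theorem eigenvector_ae_eq {f : L2T} {z : ℂ} (hf : kalishOperator f = z • f) :
    ∀ᵐ t : ℝ, t ∈ Set.Ioo 0 (2 * Real.pi) →
      (exp (t * I) - z) * f (t : 𝕋) = kalishPrimitive f t := by
  have h1 : ∀ᵐ x ∂(AddCircle.haarAddCircle : Measure 𝕋), kalishFun f x = z * f x := by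
    filter_upwards [(memLp_kalishFun f).coeFn_toLp, Lp.coeFn_smul z f] with x a1 a2
    rw [← a1, ← kalishOperator_apply, hf, a2, Pi.smul_apply, smul_eq_mul]
  filter_upwards [ae_real_of_ae_circle h1] with t ht hmem
  have h2 := ht ⟨hmem.1, hmem.2.le⟩
  rw [kalishFun, kalishIntegral, angle_coe_of_mem ⟨hmem.1.le, hmem.2⟩] at h2
  rw [kalishPrimitive]
  linear_combination h2

theorem continuousOn_kalishPrimitive (f : L2T) :
    ContinuousOn (kalishPrimitive f) (Set.Icc 0 (2 * Real.pi)) := by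
  have h := intervalIntegral.continuousOn_primitive_interval' (intervalIntegrable_of_L2T f)
    Set.left_mem_uIcc
  rwa [Set.uIcc_of_le Real.two_pi_pos.le] at h

/-- On an interval where `e^{it} ≠ z`, the function `kalishPrimitive f t / (e^{it} - z)` of an
eigenvector `f` is constant; so it vanishes there if it vanishes at the left endpoint. -/
theorem eigenvector_eq_zero_on {f : L2T} {z : ℂ} (hf : kalishOperator f = z • f) {a b : ℝ}
    (ha : 0 ≤ a) (hb : b ≤ 2 * Real.pi) (hz : ∀ t ∈ Set.Icc a b, exp (t * I) ≠ z)
    (h0 : kalishPrimitive f a = 0) :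
    (∀ t ∈ Set.Icc a b, kalishPrimitive f t = 0) ∧
      ∀ᵐ t : ℝ, t ∈ Set.Ioo a b → f (t : 𝕋) = 0 := by
  rcases lt_or_ge b a with hab | hab
  · exact ⟨fun t ht => absurd (ht.1.trans ht.2) (not_le.2 hab), Eventually.of_forall fun t ht =>
      absurd (ht.1.trans ht.2) (not_lt.2 hab.le)⟩
  set F := kalishPrimitive f with hF
  have hsub : Set.Icc a b ⊆ Set.Icc 0 (2 * Real.pi) := Set.Icc_subset_Icc ha hb
  have hFc : ContinuousOn F (Set.Icc a b) := (continuousOn_kalishPrimitive f).mono hsub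
  have hne : ∀ t ∈ Set.Icc a b, exp (t * I) - z ≠ 0 := fun t ht => sub_ne_zero.2 (hz t ht)
  set k : ℝ → ℂ := fun t => I * exp (t * I) * (F t / (exp (t * I) - z)) with hk
  have hkc : ContinuousOn k (Set.Icc a b) := by
    refine ContinuousOn.mul (by fun_prop) (hFc.div (by fun_prop) hne)
  have hae : ∀ᵐ t : ℝ, t ∈ Set.Ioo a b → f (t : 𝕋) = F t / (exp (t * I) - z) := by
    filter_upwards [eigenvector_ae_eq hf] with t ht hmem
    rw [eq_div_iff (hne t (Set.Ioo_subset_Icc_self hmem)), mul_comm]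
    exact ht ⟨ha.trans_lt hmem.1, hmem.2.trans_le hb⟩
  have hFint : ∀ t ∈ Set.Icc a b, F t = ∫ s in a..t, k s := by
    intro t ht
    have hi : ∀ u ∈ Set.Icc 0 (2 * Real.pi), IntervalIntegrable
        (fun t : ℝ => I * exp (t * I) * f (t : 𝕋)) volume 0 u := fun u hu => by
      refine (intervalIntegrable_of_L2T f).mono_set ?_
      rw [Set.uIcc_of_le hu.1, Set.uIcc_of_le Real.two_pi_pos.le]
      exact Set.Icc_subset_Icc_right hu.2
    have h1 := intervalIntegral.integral_interval_sub_left (hi t (hsub ht))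
      (hi a (hsub ⟨le_rfl, hab⟩))
    have h2 : F t = ∫ s in a..t, I * exp (s * I) * f (s : 𝕋) := by
      rw [← h1]
      change F t = F t - F a
      rw [h0, sub_zero]
    rw [h2]
    refine intervalIntegral.integral_congr_ae ?_
    have hb' : ∀ᵐ s : ℝ, s ≠ b := by simp [ae_iff]
    filter_upwards [hae, hb'] with s hs hsb hmem
    rw [Set.uIoc_of_le ht.1] at hmem
    rw [hs ⟨hmem.1, lt_of_le_of_ne (hmem.2.trans ht.2) hsb⟩]
  have hFd : ∀ t ∈ Set.Ico a b, HasDerivWithinAt F (k t) (Set.Ici t) t := by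
    intro t ht
    have hki : IntervalIntegrable k volume a t :=
      (hkc.mono (Set.Icc_subset_Icc_right ht.2.le)).intervalIntegrable_of_Icc ht.1
    have hcw : ContinuousWithinAt k (Set.Ioi t) t :=
      (hkc t ⟨ht.1, ht.2.le⟩).mono_of_mem_nhdsWithin
        (mem_of_superset (Ioo_mem_nhdsGT ht.2) fun s hs => ⟨ht.1.trans hs.1.le, hs.2.le⟩)
    have hsm : StronglyMeasurableAtFilter k (𝓝[>] t) volume :=
      ⟨Set.Ioo t b, Ioo_mem_nhdsGT ht.2,
        (hkc.mono fun s hs => ⟨ht.1.trans hs.1.le, hs.2.le⟩).aestronglyMeasurable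
          measurableSet_Ioo⟩
    have hd := intervalIntegral.integral_hasDerivWithinAt_right (s := Set.Ici t) (t := Set.Ioi t)
      hki hsm hcw
    refine hd.congr_of_eventuallyEq ?_ (hFint t ⟨ht.1, ht.2.le⟩)
    filter_upwards [Ico_mem_nhdsGE ht.2] with s hs
    exact hFint s ⟨ht.1.trans hs.1, hs.2.le⟩
  have hconst := constant_of_has_deriv_right_zero (f := fun t : ℝ => F t / (exp (t * I) - z))
    (hFc.div (by fun_prop) hne) fun t ht => by
      have hne' := hne t ⟨ht.1, ht.2.le⟩
      refine ((hFd t ht).div ((hasDerivAt_exp_mul_I t).sub_const z).hasDerivWithinAt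
        hne').congr_deriv ?_
      simp only [hk]
      rw [mul_assoc, div_mul_cancel₀ _ hne']
      ring
  have hF0 : ∀ t ∈ Set.Icc a b, F t = 0 := fun t ht => by
    have := hconst t ht
    rw [h0, zero_div, div_eq_zero_iff] at this
    exact this.resolve_right (hne t ht)
  refine ⟨hF0, ?_⟩
  filter_upwards [hae] with t ht hmem
  rw [ht hmem, hF0 t (Set.Ioo_subset_Icc_self hmem), zero_div]

theorem exp_mul_I_ne {s t : ℝ} (hs : s ∈ Set.Ico 0 (2 * Real.pi))
    (ht : t ∈ Set.Ico 0 (2 * Real.pi)) (hst : s ≠ t) : exp (s * I) ≠ exp (t * I) := by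
  intro h
  obtain ⟨n, hn⟩ := Complex.exp_eq_exp_iff_exists_int.1 h
  have h1 : (s : ℂ) = t + n * (2 * Real.pi) := by
    refine mul_right_cancel₀ I_ne_zero ?_
    linear_combination hn
  have h2 : s = t + n * (2 * Real.pi) := by exact_mod_cast h1
  have hpi := Real.two_pi_pos
  have h3 : n = 0 := by
    have a1 : (n : ℝ) < 1 := by nlinarith [hs.1, hs.2, ht.1, ht.2]
    have a2 : (-1 : ℝ) < n := by nlinarith [hs.1, hs.2, ht.1, ht.2]
    have b1 : n < 1 := by exact_mod_cast a1
    have b2 : -1 < n := by exact_mod_cast a2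
    omega
  rw [h3] at h2
  simp at h2
  exact hst h2

theorem exists_exp_mul_I_eq {z : ℂ} (hz : ‖z‖ = 1) :
    ∃ t ∈ Set.Ico 0 (2 * Real.pi), exp ((t : ℝ) * I) = z := by
  have h : exp (arg z * I) = z := by
    have := norm_mul_exp_arg_mul_I z
    rwa [hz, ofReal_one, one_mul] at this
  rcases le_or_gt 0 (arg z) with h0 | h0
  · exact ⟨arg z, ⟨h0, by linarith [arg_le_pi z, Real.pi_pos]⟩, h⟩
  · refine ⟨arg z + 2 * Real.pi, ⟨by linarith [neg_pi_lt_arg z, Real.pi_pos], by linarith⟩, ?_⟩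
    push_cast
    rw [add_mul, exp_add, exp_two_pi_mul_I, mul_one, h]

theorem tendsto_exp_mul_I_nhdsGT {t : ℝ} (ht : t ∈ Set.Ico 0 (2 * Real.pi)) :
    Tendsto (fun s : ℝ => exp (s * I)) (𝓝[>] t) (𝓝[≠] exp (t * I)) := by
  refine tendsto_nhdsWithin_iff.2 ⟨?_, ?_⟩
  · have hc : Continuous fun s : ℝ => exp (s * I) := by fun_prop
    exact hc.continuousAt.tendsto.mono_left nhdsWithin_le_nhds
  · filter_upwards [Ioo_mem_nhdsGT ht.2] with s hs
    exact exp_mul_I_ne ⟨ht.1.trans hs.1.le, hs.2⟩ ht hs.1.ne'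

/-- Restriction of functions on the circle to the arc of angles less than `b`. -/
noncomputable def restrictArc (b : ℝ) :
    L2T →L[ℂ] Lp ℂ 2 ((AddCircle.haarAddCircle : Measure 𝕋).restrict {x | angle x < b}) :=
  LpToLpRestrictCLM 𝕋 ℂ ℂ AddCircle.haarAddCircle 2 {x | angle x < b}

theorem measurableSet_angle_lt (b : ℝ) : MeasurableSet {x : 𝕋 | angle x < b} :=
  measurableSet_lt measurable_angle measurable_const

theorem ae_mem_Ioo_of_mem_Ioc {a b : ℝ} : ∀ᵐ t : ℝ, t ∈ Set.Ioc a b → t ∈ Set.Ioo a b := by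
  have h : ∀ᵐ t : ℝ, t ≠ b := by simp [ae_iff]
  filter_upwards [h] with t ht hm using ⟨hm.1, lt_of_le_of_ne hm.2 ht⟩

theorem restrictArc_eq_zero_iff {b : ℝ} (hb : b ≤ 2 * Real.pi) (f : L2T) :
    restrictArc b f = 0 ↔ ∀ᵐ t : ℝ, t ∈ Set.Ioo 0 b → f (t : 𝕋) = 0 := by
  have hm : MeasurableSet {x : 𝕋 | angle x < b → f x = 0} := by
    have : {x : 𝕋 | angle x < b → f x = 0} = {x | angle x < b}ᶜ ∪ {x | f x = 0} := by
      ext x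
      exact imp_iff_not_or
    rw [this]
    exact (measurableSet_angle_lt b).compl.union
      (measurableSet_eq_fun (Lp.stronglyMeasurable f).measurable measurable_const)
  have h1 : restrictArc b f = 0 ↔
      ∀ᵐ x ∂(AddCircle.haarAddCircle : Measure 𝕋), angle x < b → f x = 0 := by
    refine Iff.trans ?_ (ae_restrict_iff' (measurableSet_angle_lt b))
    rw [Lp.eq_zero_iff_ae_eq_zero]
    have h2 : restrictArc b f =ᵐ[(AddCircle.haarAddCircle : Measure 𝕋).restrict
        {x | angle x < b}] f := LpToLpRestrictCLM_coeFn ℂ _ f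
    constructor
    · intro h
      filter_upwards [h, h2] with x a1 a2
      rw [← a2, a1, Pi.zero_apply]
    · intro h
      filter_upwards [h, h2] with x a1 a2
      rw [a2, a1, Pi.zero_apply]
  rw [h1]
  constructor
  · intro h
    filter_upwards [ae_real_of_ae_circle h] with t ht hmem
    refine ht ⟨hmem.1, hmem.2.le.trans hb⟩ ?_
    rw [angle_coe_of_mem ⟨hmem.1.le, hmem.2.trans_le hb⟩]
    exact hmem.2
  · intro h
    refine ae_circle_of_ae_real hm ?_
    filter_upwards [h, ae_mem_Ioo_of_mem_Ioc (a := 0) (b := 2 * Real.pi)] with t ht h2 hmem hlt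
    have h3 := h2 hmem
    rw [angle_coe_of_mem ⟨h3.1.le, h3.2⟩] at hlt
    exact ht ⟨h3.1, hlt⟩

theorem eq_zero_of_ae_real {f : L2T}
    (h : ∀ᵐ t : ℝ, t ∈ Set.Ioo 0 (2 * Real.pi) → f (t : 𝕋) = 0) : f = 0 := by
  refine (Lp.eq_zero_iff_ae_eq_zero).2 (ae_circle_of_ae_real
    (measurableSet_eq_fun (Lp.stronglyMeasurable f).measurable measurable_const) ?_)
  filter_upwards [h, ae_mem_Ioo_of_mem_Ioc (a := 0) (b := 2 * Real.pi)] with t ht h2 hmem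
  exact ht (h2 hmem)

/-- An eigenvector for the eigenvalue `e^{is}` vanishes on the arc of angles less than `s`. -/
theorem eigenvector_restrictArc_eq_zero {f : L2T} {s b : ℝ} (hs : s < 2 * Real.pi) (hb : b < s)
    (hb0 : 0 ≤ b) (hf : kalishOperator f = exp (s * I) • f) : restrictArc b f = 0 := by
  refine (restrictArc_eq_zero_iff (hb.trans hs).le f).2
    (eigenvector_eq_zero_on hf le_rfl (hb.trans hs).le (fun t ht => ?_) ?_).2
  · exact exp_mul_I_ne ⟨ht.1, ht.2.trans_lt (hb.trans hs)⟩ ⟨hb0.trans hb.le, hs⟩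
      (ht.2.trans_lt hb).ne
  · simp [kalishPrimitive]

/-- An eigenvector for the eigenvalue `e^{is}` that vanishes up to an angle larger than `s`
vanishes identically. -/
theorem eigenvector_eq_zero {f : L2T} {s b : ℝ} (hs : 0 < s) (hb : s < b) (hb2 : b < 2 * Real.pi)
    (hf : kalishOperator f = exp (s * I) • f) (h0 : restrictArc b f = 0) : f = 0 := by
  have h1 := (restrictArc_eq_zero_iff hb2.le f).1 h0
  have hFb : kalishPrimitive f b = 0 := by
    rw [kalishPrimitive]
    refine intervalIntegral.integral_zero_ae ?_
    filter_upwards [h1, ae_mem_Ioo_of_mem_Ioc (a := 0) (b := b)] with t ht h2 hmem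
    rw [Set.uIoc_of_le (hs.trans hb).le] at hmem
    rw [ht (h2 hmem), mul_zero]
  have h2 := (eigenvector_eq_zero_on hf (hs.trans hb).le le_rfl (fun t ht => ?_) hFb).2
  · refine eq_zero_of_ae_real ?_
    have hne : ∀ᵐ t : ℝ, t ≠ b := by simp [ae_iff]
    filter_upwards [h1, h2, hne] with t a1 a2 a3 hmem
    rcases lt_or_gt_of_ne a3 with h | h
    · exact a1 ⟨hmem.1, h⟩
    · exact a2 ⟨h, hmem.2⟩
  · rcases ht.2.lt_or_eq with h | h
    · exact exp_mul_I_ne ⟨(hs.trans hb).le.trans ht.1, h⟩ ⟨hs.le, hb.trans hb2⟩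
        (hb.trans_le ht.1).ne'
    · have h3 : exp (t * I) = exp ((0 : ℝ) * I) := by
        rw [h]; push_cast; rw [exp_two_pi_mul_I]; simp
      rw [h3]
      exact exp_mul_I_ne ⟨le_rfl, Real.two_pi_pos⟩ ⟨hs.le, hb.trans hb2⟩ hs.ne

/-- The Kalish operator has no non-zero eigenvectorfield that is analytic near a point of `𝕋`. An
eigenvector at `e^{is}` lives on angles above `s`, and analyticity in `s` does not let the support
move. -/
theorem eventually_eq_zero_of_isAnalyticEigenvectorfieldNear {z₀ : ℂ} {E : ℂ → L2T}
    (hz₀ : ‖z₀‖ = 1) (hE : IsAnalyticEigenvectorfieldNear kalishOperator E z₀) :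
    ∀ᶠ z in 𝓝 z₀, E z = 0 := by
  obtain ⟨hEa, hEe⟩ := hE
  obtain ⟨a, ha, rfl⟩ := exists_exp_mul_I_eq hz₀
  obtain ⟨ε, hε, hball⟩ := Metric.eventually_nhds_iff_ball.1 (hEa.eventually_analyticAt.and hEe)
  have hc : Continuous fun s : ℝ => exp (s * I) := by fun_prop
  obtain ⟨c, hac, hc2, hcball⟩ : ∃ c, a < c ∧ c ≤ 2 * Real.pi ∧
      ∀ s ∈ Set.Ioo a c, exp ((s : ℝ) * I) ∈ Metric.ball (exp (a * I)) ε := by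
    obtain ⟨η, hη, hηball⟩ := Metric.eventually_nhds_iff_ball.1
      (hc.continuousAt.eventually (Metric.ball_mem_nhds (exp (a * I)) hε))
    refine ⟨min (a + η) (2 * Real.pi), lt_min (by linarith) ha.2, min_le_right _ _,
      fun s hs => hηball s ?_⟩
    rw [Metric.mem_ball, Real.dist_eq, abs_of_pos (sub_pos.2 hs.1)]
    linarith [hs.2.trans_le (min_le_left _ _)]
  have heig : ∀ s ∈ Set.Ioo a c,
      kalishOperator (E (exp ((s : ℝ) * I))) = exp (s * I) • E (exp (s * I)) := fun s hs =>
    (hball _ (hcball s hs)).2 (norm_exp_ofReal_mul_I s)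
  obtain ⟨b, hab, hbc⟩ := exists_between hac
  obtain ⟨d, hbd, hdc⟩ := exists_between hbc
  have hb0 : 0 ≤ b := ha.1.trans hab.le
  -- The restriction to the arc below `b` vanishes for the eigenvalues on the arc from `b` to `c`,
  -- hence on the whole disc.
  have hzero : Set.EqOn (fun z => restrictArc b (E z)) 0 (Metric.ball (exp (a * I)) ε) := by
    have han : AnalyticOnNhd ℂ (fun z => restrictArc b (E z)) (Metric.ball (exp (a * I)) ε) :=
      (restrictArc b).comp_analyticOnNhd fun z hz => (hball z hz).1
    refine han.eqOn_zero_of_preconnected_of_frequently_eq_zero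
      (convex_ball _ _).isPreconnected (hcball d ⟨hab.trans hbd, hdc⟩) ?_
    refine (tendsto_exp_mul_I_nhdsGT ⟨hb0.trans hbd.le, hdc.trans_le hc2⟩).frequently
      (Eventually.frequently ?_)
    filter_upwards [Ioo_mem_nhdsGT hdc] with s hs
    exact eigenvector_restrictArc_eq_zero (hs.2.trans_le hc2) (hbd.trans hs.1) hb0
      (heig s ⟨(hab.trans hbd).trans hs.1, hs.2⟩)
  rw [← hEa.frequently_zero_iff_eventually_zero]
  refine (tendsto_exp_mul_I_nhdsGT ha).frequently (Eventually.frequently ?_)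
  filter_upwards [Ioo_mem_nhdsGT hab] with s hs
  have hsc : s ∈ Set.Ioo a c := ⟨hs.1, hs.2.trans hbc⟩
  exact eigenvector_eq_zero (ha.1.trans_lt hs.1) hs.2 (hbc.trans_le hc2) (heig s hsc)
    (hzero (hcball s hsc))

end Eigenvectors

theorem mainTheorem9 :
    UniversalForInvertibleErgodicSystems.{u} kalishOperator ∧
    ∀ (z₀ : ℂ) (E : ℂ → L2T), ‖z₀‖ = 1 →
      IsAnalyticEigenvectorfieldNear kalishOperator E z₀ → ∀ᶠ z in 𝓝 z₀, E z = 0 :=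
  ⟨kalishOperator_universal, fun _ _ hz₀ hE =>
    eventually_eq_zero_of_isAnalyticEigenvectorfieldNear hz₀ hE⟩
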